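/- Let $\rho$ be a Banach function norm on the nonnegative Lebesgue measurable functions $f:\mathbb{R}\to[0,\infty]$, that is, for all such $f,g,f_n$, all constants $a\ge 0$ and all measurable $E\subset\mathbb{R}$: $\rho(f)=0$ iff $f=0$ a.e.; $\rho(af)=a\rho(f)$; $\rho(f+g)\le\rho(f)+\rho(g)$; $0\le g\le f$ a.e. implies $\rho(g)\le\rho(f)$; $0\le f_n\uparrow f$ a.e. implies $\rho(f_n)\uparrow\rho(f)$; if $|E|<\infty$, then $\rho(\chi_E)<\infty$ and there is $C_E<\infty$, independent of $f$, with $\int_E f\,dx\le C_E\,\rho(f)$. Let $X(\mathbb{R})$ be the Banach function space of all (classes of a.e. equal) measurable $f:\mathbb{R}\to\mathbb{C}$ with $\|f\|_{X(\mathbb{R})}:=\rho(|f|)<\infty$, and let its associate space $X'(\mathbb{R})$ be the Banach function space determined by the associate norm $\rho'(g)=\sup\{\int_{\mathbb{R}} fg\,dx : f\ge 0 \text{ measurable},\ \rho(f)\le 1\}$. Suppose that $X(\mathbb{R})$ is reflexive and that the Hardy–Littlewood maximal operator $$(Mf)(x)=\sup_{Q\ni x}\frac1{|Q|}\int_Q|f(y)|\,dy$$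 (supremum over all intervals $Q$ of finite positive length containing $x$) is bounded on $X(\mathbb{R})$ and on $X'(\mathbb{R})$. Let $(Ff)(x)=\int_{\mathbb{R}}f(t)e^{itx}\,dt$ be the Fourier transform on $L^2(\mathbb{R})$. A function $b\in L^\infty(\mathbb{R})$ is a Fourier multiplier on $X(\mathbb{R})$ if $F^{-1}bF$ maps $L^2(\mathbb{R})\cap X(\mathbb{R})$ into $X(\mathbb{R})$ and extends to a bounded linear operator $W^0(b)$ on $X(\mathbb{R})$; its multiplier norm is the operator norm of $W^0(b)$. (The extension is unique, because the reflexive space $X(\mathbb{R})$ is separable and hence $L^2(\mathbb{R})\cap X(\mathbb{R})$ is dense in it.) Let $\dot{\mathbb{R}}=\mathbb{R}\cup\{\infty\}$ be the one-point compactification of $\mathbb{R}$, let $C(\dot{\mathbb{R}})$ be the algebra of continuous complex functions on it, and let $C_X(\dot{\mathbb{R}})$ be the closure, in the multiplier norm, of the set of functions in $C(\dot{\mathbb{R}})$ that have finite total variation on $\mathbb{R}$. Then every compact linear operator on $X(\mathbb{R})$ belongs to the smallest norm-closed subalgebra of the algebra of bounded linear operators on $X(\mathbb{R})$ that contains all multiplication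 operators $aI$ with $a\in C(\dot{\mathbb{R}})$ and all operators $W^0(b)$ with $b\in C_X(\dot{\mathbb{R}})$. -/

import Mathlib

open MeasureTheory Filter Topology
open scoped ENNReal NNReal

noncomputable section

/-- A Banach function norm on the Lebesgue measurable functions `ℝ → [0, ∞]`.
Lebesgue measurable functions are the `AEMeasurable` ones, Lebesgue measurable sets the
`NullMeasurableSet` ones. The values of `toFun` on nonmeasurable functions are irrelevant. -/
structure BanachFunctionNorm where
  toFun : (ℝ → ℝ≥0∞) → ℝ≥0∞
  eq_zero_iff' : ∀ f : ℝ → ℝ≥0∞, AEMeasurable f volume →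
    (toFun f = 0 ↔ ∀ᵐ x ∂(volume : Measure ℝ), f x = 0)
  smul' : ∀ (a : ℝ≥0) (f : ℝ → ℝ≥0∞), AEMeasurable f volume →
    toFun (fun x => (a : ℝ≥0∞) * f x) = a * toFun f
  add_le' : ∀ f g : ℝ → ℝ≥0∞, AEMeasurable f volume → AEMeasurable g volume →
    toFun (fun x => f x + g x) ≤ toFun f + toFun g
  mono' : ∀ f g : ℝ → ℝ≥0∞, AEMeasurable f volume → AEMeasurable g volume →
    (∀ᵐ x ∂(volume : Measure ℝ), g x ≤ f x) → toFun g ≤ toFun f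
  fatou' : ∀ (f : ℝ → ℝ≥0∞) (u : ℕ → ℝ → ℝ≥0∞), AEMeasurable f volume →
    (∀ n, AEMeasurable (u n) volume) →
    (∀ᵐ x ∂(volume : Measure ℝ),
      Monotone (fun n => u n x) ∧ Tendsto (fun n => u n x) atTop (𝓝 (f x))) →
    Tendsto (fun n => toFun (u n)) atTop (𝓝 (toFun f))
  indicator_lt_top' : ∀ E : Set ℝ, NullMeasurableSet E volume → volume E < ∞ →
    toFun (E.indicator fun _ => 1) < ∞
  lintegral_le' : ∀ E : Set ℝ, NullMeasurableSet E volume → volume E < ∞ →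
    ∃ C : ℝ≥0, ∀ f : ℝ → ℝ≥0∞, AEMeasurable f volume →
      ∫⁻ x in E, f x ≤ C * toFun f

namespace BanachFunctionNorm

variable (ρ : BanachFunctionNorm)

/-! ### The associate norm -/

/-- The associate functional `ρ'(g) = sup { ∫ f g : f measurable, ρ(f) ≤ 1 }`. -/
def associateFun (g : ℝ → ℝ≥0∞) : ℝ≥0∞ :=
  ⨆ (f : ℝ → ℝ≥0∞) (_ : AEMeasurable f volume) (_ : ρ.toFun f ≤ 1), ∫⁻ x, f x * g x

theorem le_associateFun {f : ℝ → ℝ≥0∞} (hf : AEMeasurable f volume) (h : ρ.toFun f ≤ 1)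
    (g : ℝ → ℝ≥0∞) : ∫⁻ x, f x * g x ≤ ρ.associateFun g :=
  le_iSup_of_le f (le_iSup_of_le hf (le_iSup_of_le h le_rfl))

theorem associateFun_le {g : ℝ → ℝ≥0∞} {C : ℝ≥0∞}
    (h : ∀ f : ℝ → ℝ≥0∞, AEMeasurable f volume → ρ.toFun f ≤ 1 → ∫⁻ x, f x * g x ≤ C) :
    ρ.associateFun g ≤ C :=
  iSup_le fun f => iSup_le fun hf => iSup_le fun h1 => h f hf h1

theorem associateFun_mono {f g : ℝ → ℝ≥0∞} (h : ∀ᵐ x ∂(volume : Measure ℝ), g x ≤ f x) :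
    ρ.associateFun g ≤ ρ.associateFun f := by
  refine ρ.associateFun_le fun u hu h1 => le_trans ?_ (ρ.le_associateFun hu h1 f)
  refine lintegral_mono_ae ?_
  filter_upwards [h] with x hx
  gcongr

theorem aemeasurable_indicator_one {E : Set ℝ} (hE : NullMeasurableSet E volume) :
    AEMeasurable (E.indicator fun _ => (1 : ℝ≥0∞)) volume :=
  aemeasurable_const.indicator₀ hE

theorem lintegral_le_associateFun {E : Set ℝ} (hE : NullMeasurableSet E volume)
    (hfin : volume E < ∞) :
    ∃ C : ℝ≥0, ∀ g : ℝ → ℝ≥0∞, AEMeasurable g volume →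
      ∫⁻ x in E, g x ≤ C * ρ.associateFun g := by
  have hχ := aemeasurable_indicator_one hE
  have htop := ρ.indicator_lt_top' E hE hfin
  obtain ⟨c, hc⟩ : ∃ c : ℝ≥0, (c : ℝ≥0∞) = ρ.toFun (E.indicator fun _ => 1) :=
    ⟨_, ENNReal.coe_toNNReal htop.ne⟩
  refine ⟨c, fun g hg => ?_⟩
  rcases eq_or_ne c 0 with h0 | h0
  · have hz : ∀ᵐ x ∂(volume : Measure ℝ), E.indicator (fun _ => (1 : ℝ≥0∞)) x = 0 :=
      (ρ.eq_zero_iff' _ hχ).1 (by rw [← hc, h0]; rfl)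
    have hE0 : volume E = 0 := by
      refine measure_mono_null (fun x hx => ?_) (ae_iff.1 hz)
      simp [hx]
    simp [Measure.restrict_eq_zero.2 hE0]
  · have h1 : ρ.toFun (fun x => ((c⁻¹ : ℝ≥0) : ℝ≥0∞) * E.indicator (fun _ => 1) x) ≤ 1 := by
      rw [ρ.smul' _ _ hχ, ← hc, ← ENNReal.coe_mul, inv_mul_cancel₀ h0]; simp
    have h2 := ρ.le_associateFun (hχ.const_mul _) h1 g
    have h3 : ∫⁻ x, ((c⁻¹ : ℝ≥0) : ℝ≥0∞) * E.indicator (fun _ => 1) x * g x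
        = ((c⁻¹ : ℝ≥0) : ℝ≥0∞) * ∫⁻ x in E, g x := by
      rw [← lintegral_indicator₀ hE, ← lintegral_const_mul' _ _ ENNReal.coe_ne_top]
      refine lintegral_congr fun x => ?_
      by_cases hx : x ∈ E <;> simp [hx]
    rw [h3] at h2
    calc ∫⁻ x in E, g x = (c : ℝ≥0∞) * (((c⁻¹ : ℝ≥0) : ℝ≥0∞) * ∫⁻ x in E, g x) := by
          rw [← mul_assoc, ← ENNReal.coe_mul, mul_inv_cancel₀ h0]; simp
      _ ≤ c * ρ.associateFun g := by gcongr

/-- The associate norm `ρ'`; it is itself a Banach function norm. -/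
def associate : BanachFunctionNorm where
  toFun := ρ.associateFun
  eq_zero_iff' g hg := by
    constructor
    · intro h0
      have hn : ∀ n : ℕ, ∀ᵐ x ∂(volume : Measure ℝ), x ∈ Set.Icc (-(n : ℝ)) n → g x = 0 := by
        intro n
        obtain ⟨C, hC⟩ := ρ.lintegral_le_associateFun (E := Set.Icc (-(n : ℝ)) n)
          measurableSet_Icc.nullMeasurableSet (by simp)
        have h1 := hC g hg
        rw [h0, mul_zero, nonpos_iff_eq_zero, lintegral_eq_zero_iff' hg.restrict] at h1
        exact (ae_restrict_iff' measurableSet_Icc).1 h1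
      filter_upwards [ae_all_iff.2 hn] with x hx
      obtain ⟨n, hn⟩ := exists_nat_ge |x|
      exact hx n (abs_le.1 hn)
    · intro h
      refine le_antisymm (ρ.associateFun_le fun f hf h1 => ?_) bot_le
      rw [lintegral_congr_ae (g := fun _ => 0) (by filter_upwards [h] with x hx; simp [hx])]
      simp
  smul' a g hg := by
    simp only [associateFun, ENNReal.mul_iSup]
    refine iSup_congr fun f => iSup_congr fun hf => iSup_congr fun h1 => ?_
    rw [← lintegral_const_mul' _ _ ENNReal.coe_ne_top]
    exact lintegral_congr fun x => by ring
  add_le' f g hf hg := by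
    refine ρ.associateFun_le fun u hu h1 => ?_
    simp only [mul_add]
    refine (lintegral_add_left' (hu.mul hf) _).trans_le ?_
    exact add_le_add (ρ.le_associateFun hu h1 f) (ρ.le_associateFun hu h1 g)
  mono' f g _ _ h := ρ.associateFun_mono h
  fatou' f u hf hu h := by
    have hmono : Monotone fun n => ρ.associateFun (u n) := fun m n hmn =>
      ρ.associateFun_mono (by filter_upwards [h] with x hx using hx.1 hmn)
    have hle : ∀ n, ρ.associateFun (u n) ≤ ρ.associateFun f := fun n =>
      ρ.associateFun_mono (by filter_upwards [h] with x hx using hx.1.ge_of_tendsto hx.2 n)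
    have heq : ρ.associateFun f = ⨆ n, ρ.associateFun (u n) := by
      refine le_antisymm (ρ.associateFun_le fun v hv h1 => ?_) (iSup_le hle)
      have ht : Tendsto (fun n => ∫⁻ x, v x * u n x) atTop (𝓝 (∫⁻ x, v x * f x)) := by
        refine lintegral_tendsto_of_tendsto_of_monotone (fun n => hv.mul (hu n)) ?_ ?_
        · filter_upwards [h] with x hx m n hmn
          exact mul_le_mul_right (hx.1 hmn) _
        · filter_upwards [h] with x hx
          have : f x = ⨆ n, u n x := tendsto_nhds_unique hx.2 (tendsto_atTop_iSup hx.1)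
          rw [this, ENNReal.mul_iSup]
          exact tendsto_atTop_iSup fun m n hmn => mul_le_mul_right (hx.1 hmn) _
      exact le_of_tendsto' ht fun n =>
        (ρ.le_associateFun hv h1 (u n)).trans (le_iSup (fun n => ρ.associateFun (u n)) n)
    rw [heq]
    exact tendsto_atTop_iSup hmono
  indicator_lt_top' E hE hfin := by
    obtain ⟨C, hC⟩ := ρ.lintegral_le' E hE hfin
    refine lt_of_le_of_lt (ρ.associateFun_le (C := C) fun f hf h1 => ?_) ENNReal.coe_lt_top
    have : ∫⁻ x, f x * E.indicator (fun _ => 1) x = ∫⁻ x in E, f x := by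
      rw [← lintegral_indicator₀ hE]
      refine lintegral_congr fun x => ?_
      by_cases hx : x ∈ E <;> simp [hx]
    rw [this]
    calc ∫⁻ x in E, f x ≤ C * ρ.toFun f := hC f hf
      _ ≤ C * 1 := by gcongr
      _ = C := mul_one _
  lintegral_le' E hE hfin := ρ.lintegral_le_associateFun hE hfin

/-! ### The Banach function space -/

theorem aemeasurable_enorm (f : ℝ →ₘ[volume] ℂ) :
    AEMeasurable (fun x => ‖f x‖ₑ) volume :=
  f.aestronglyMeasurable.enorm

theorem toFun_congr {f g : ℝ → ℝ≥0∞} (hf : AEMeasurable f volume)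
    (h : f =ᵐ[volume] g) : ρ.toFun f = ρ.toFun g :=
  le_antisymm (ρ.mono' _ _ (hf.congr h) hf h.le) (ρ.mono' _ _ hf (hf.congr h) h.symm.le)

/-- `ρ(|f|)` for a class `f` of measurable functions modulo equality almost everywhere. -/
def eval (f : ℝ →ₘ[volume] ℂ) : ℝ≥0∞ := ρ.toFun fun x => ‖f x‖ₑ

theorem eval_add_le (f g : ℝ →ₘ[volume] ℂ) : ρ.eval (f + g) ≤ ρ.eval f + ρ.eval g := by
  refine le_trans (ρ.mono' _ _ ((aemeasurable_enorm f).add (aemeasurable_enorm g))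
    (aemeasurable_enorm _) ?_) (ρ.add_le' _ _ (aemeasurable_enorm f) (aemeasurable_enorm g))
  filter_upwards [AEEqFun.coeFn_add f g] with x hx
  rw [hx]
  exact enorm_add_le _ _

theorem eval_smul (c : ℂ) (f : ℝ →ₘ[volume] ℂ) : ρ.eval (c • f) = ‖c‖ₑ * ρ.eval f := by
  refine (ρ.toFun_congr (aemeasurable_enorm _) ?_).trans
    (ρ.smul' ‖c‖₊ _ (aemeasurable_enorm f))
  filter_upwards [AEEqFun.coeFn_smul c f] with x hx
  rw [hx, Pi.smul_apply, enorm_smul]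
  rfl

theorem eval_eq_zero_iff (f : ℝ →ₘ[volume] ℂ) : ρ.eval f = 0 ↔ f = 0 := by
  rw [eval, ρ.eq_zero_iff' _ (aemeasurable_enorm f)]
  constructor
  · intro h
    refine AEEqFun.ext ?_
    filter_upwards [h, AEEqFun.coeFn_zero (α := ℝ) (β := ℂ) (μ := volume)] with x hx h0
    rw [h0]
    simpa using hx
  · rintro rfl
    filter_upwards [AEEqFun.coeFn_zero (α := ℝ) (β := ℂ) (μ := volume)] with x h0
    simp [h0]

/-- The linear space of the classes `f` with `ρ(|f|) < ∞`. -/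
def submodule : Submodule ℂ (ℝ →ₘ[volume] ℂ) where
  carrier := {f | ρ.eval f < ∞}
  zero_mem' := by
    change ρ.eval 0 < ∞
    rw [(ρ.eval_eq_zero_iff 0).2 rfl]
    exact ENNReal.zero_lt_top
  add_mem' {f g} hf hg := (ρ.eval_add_le f g).trans_lt (ENNReal.add_lt_top.2 ⟨hf, hg⟩)
  smul_mem' c f hf := by
    change ρ.eval (c • f) < ∞
    rw [eval_smul]
    exact ENNReal.mul_lt_top enorm_lt_top hf

/-- The Banach function space `X(ℝ)` determined by `ρ`. -/
def Space : Type := ρ.submodule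

namespace Space

instance : AddCommGroup ρ.Space := inferInstanceAs (AddCommGroup ρ.submodule)

instance : Module ℂ ρ.Space := inferInstanceAs (Module ℂ ρ.submodule)

variable {ρ}

/-- The underlying class of measurable functions. -/
def val (f : ρ.Space) : ℝ →ₘ[volume] ℂ := Subtype.val f

theorem eval_val_lt_top (f : ρ.Space) : ρ.eval f.val < ∞ := f.2

theorem val_injective : Function.Injective (val : ρ.Space → ℝ →ₘ[volume] ℂ) :=
  Subtype.val_injective

theorem val_add (f g : ρ.Space) : (f + g).val = f.val + g.val := rfl

theorem val_smul (c : ℂ) (f : ρ.Space) : (c • f).val = c • f.val := rfl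

theorem val_zero : (0 : ρ.Space).val = 0 := rfl

/-- `‖f‖ = ρ(|f|)`. -/
instance : Norm ρ.Space := ⟨fun f => (ρ.eval f.val).toReal⟩

theorem norm_def (f : ρ.Space) : ‖f‖ = (ρ.eval f.val).toReal := rfl

theorem normedSpaceCore : NormedSpace.Core ℂ ρ.Space where
  norm_nonneg _ := ENNReal.toReal_nonneg
  norm_smul c f := by
    rw [norm_def, val_smul, eval_smul, ENNReal.toReal_mul, toReal_enorm, norm_def]
  norm_triangle f g := by
    rw [norm_def, norm_def, norm_def,
      ← ENNReal.toReal_add f.eval_val_lt_top.ne g.eval_val_lt_top.ne]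
    exact ENNReal.toReal_mono
      (ENNReal.add_lt_top.2 ⟨f.eval_val_lt_top, g.eval_val_lt_top⟩).ne (ρ.eval_add_le _ _)
  norm_eq_zero_iff f := by
    rw [norm_def, ENNReal.toReal_eq_zero_iff, or_iff_left f.eval_val_lt_top.ne,
      eval_eq_zero_iff, ← val_zero, val_injective.eq_iff]

instance : NormedAddCommGroup ρ.Space := NormedAddCommGroup.ofCore normedSpaceCore

instance : NormedSpace ℂ ρ.Space := NormedSpace.ofCore normedSpaceCore

end Space

/-- Reflexivity of `X(ℝ)`: the canonical embedding into the bidual is onto. -/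
def IsReflexive : Prop :=
  Function.Surjective (NormedSpace.inclusionInDoubleDual ℂ ρ.Space)

end BanachFunctionNorm

/-! ### The Hardy–Littlewood maximal operator -/

/-- The noncentered maximal function `x ↦ sup_{Q ∋ x} |Q|⁻¹ ∫_Q f` of a function `f ≥ 0`.
Every interval of finite positive length has the same averages as its closure, so the
supremum over the closed intervals is the supremum over all of them. -/
def maximalFunction (f : ℝ → ℝ≥0∞) (x : ℝ) : ℝ≥0∞ :=
  ⨆ (a : ℝ) (b : ℝ) (_ : a < b) (_ : x ∈ Set.Icc a b), ⨍⁻ y in Set.Icc a b, f y ∂volume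

/-- The maximal operator is bounded on the space determined by `ρ`:
`‖Mf‖ ≤ C ‖f‖` for all `f` in the space, with `C < ∞`. -/
def BanachFunctionNorm.MaximalBounded (ρ : BanachFunctionNorm) : Prop :=
  ∃ C : ℝ≥0, ∀ f : ρ.Space,
    ρ.toFun (maximalFunction fun x => ‖f.val x‖ₑ) ≤ C * ρ.toFun fun x => ‖f.val x‖ₑ

/-! ### Multiplication operators and Fourier convolution operators -/

namespace BanachFunctionNorm

variable (ρ : BanachFunctionNorm)

/-- The class on `ℝ` of a continuous function on `ℝ ∪ {∞}`. -/
def symbolClass (a : C(OnePoint ℝ, ℂ)) : ℝ →ₘ[volume] ℂ :=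
  AEEqFun.mk (fun x : ℝ => a (x : OnePoint ℝ))
    (a.continuous.comp OnePoint.continuous_coe).aestronglyMeasurable

theorem eval_symbolClass_mul_le (a : C(OnePoint ℝ, ℂ)) (f : ℝ →ₘ[volume] ℂ) :
    ρ.eval (symbolClass a * f) ≤ ‖a‖ₑ * ρ.eval f := by
  refine (ρ.mono' _ _ ((aemeasurable_enorm f).const_mul (‖a‖₊ : ℝ≥0∞)) (aemeasurable_enorm _)
    ?_).trans (ρ.smul' ‖a‖₊ _ (aemeasurable_enorm f)).le
  filter_upwards [AEEqFun.coeFn_mul (symbolClass a) f, AEEqFun.coeFn_mk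
    (fun x : ℝ => a (x : OnePoint ℝ))
    (a.continuous.comp OnePoint.continuous_coe).aestronglyMeasurable] with x hx hx'
  rw [hx, Pi.mul_apply, enorm_mul]
  gcongr
  rw [symbolClass, hx']
  exact enorm_le_iff_norm_le.2 (a.norm_coe_le_norm _)

/-- The multiplication operator `aI` on `X(ℝ)`, for a continuous function `a` on `ℝ ∪ {∞}`. -/
def mulOp (a : C(OnePoint ℝ, ℂ)) : ρ.Space →L[ℂ] ρ.Space :=
  LinearMap.mkContinuous
    { toFun := fun f => (⟨symbolClass a * f.val,
        (ρ.eval_symbolClass_mul_le a f.val).trans_lt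
          (ENNReal.mul_lt_top enorm_lt_top f.eval_val_lt_top)⟩ : ρ.submodule)
      map_add' := fun f g => by
        apply Space.val_injective
        change symbolClass a * (f.val + g.val) = symbolClass a * f.val + symbolClass a * g.val
        refine AEEqFun.induction_on₃ (symbolClass a) f.val g.val fun _ _ _ _ _ _ => ?_
        simp only [AEEqFun.mk_add_mk, AEEqFun.mk_mul_mk, mul_add]
      map_smul' := fun c f => by
        apply Space.val_injective
        change symbolClass a * (c • f.val) = c • (symbolClass a * f.val)
        refine AEEqFun.induction_on₂ (symbolClass a) f.val fun _ _ _ _ => ?_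
        simp only [AEEqFun.smul_mk, AEEqFun.mk_mul_mk, mul_smul_comm] }
    ‖a‖ (fun f => by
      have h := ENNReal.toReal_mono
        (ENNReal.mul_lt_top enorm_lt_top f.eval_val_lt_top).ne
        (ρ.eval_symbolClass_mul_le a f.val)
      rwa [ENNReal.toReal_mul, toReal_enorm] at h)

end BanachFunctionNorm

/-- The Fourier transform `(Ff)(x) = ∫ f(t) e^{itx} dt` on `L²(ℝ)`. Mathlib's transform is
`(𝓕 f)(ξ) = ∫ f(t) e^{-2πitξ} dt`, so that `(Ff)(x) = (𝓕 f)(-x / (2π))`. -/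
def fourierL2 (f : Lp ℂ 2 (volume : Measure ℝ)) (x : ℝ) : ℂ :=
  (Lp.fourierTransformₗᵢ ℝ ℂ f : Lp ℂ 2 (volume : Measure ℝ)) (-x / (2 * Real.pi))

namespace BanachFunctionNorm

variable (ρ : BanachFunctionNorm)

/-- `T` is the bounded operator `W⁰(b)` on `X(ℝ)`: it extends `F⁻¹ b F` from
`L²(ℝ) ∩ X(ℝ)`. The equality `T f = F⁻¹ b F f` is written as `T f ∈ L²(ℝ)` and
`F (T f) = b F f` almost everywhere. -/
def IsFourierConvolution (b : ℝ → ℂ) (T : ρ.Space →L[ℂ] ρ.Space) : Prop :=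
  ∀ (f : ρ.Space) (hf : MemLp f.val 2 volume),
    ∃ hg : MemLp (T f).val 2 volume,
      fourierL2 (hg.toLp _) =ᵐ[volume] fun x => b x * fourierL2 (hf.toLp _) x

/-- `C(ℝ ∪ {∞}) ∩ V(ℝ)`: the functions on `ℝ` of finite total variation that extend
continuously to the one-point compactification of `ℝ`. -/
def continuousBV : Set (ℝ → ℂ) :=
  {c | (∃ g : C(OnePoint ℝ, ℂ), ∀ x : ℝ, c x = g (x : OnePoint ℝ)) ∧
    BoundedVariationOn c Set.univ}

/-- The class `C_X(ℝ ∪ {∞})`: the Fourier multipliers `b ∈ L^∞(ℝ)` on `X(ℝ)` in the closure of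
`C(ℝ ∪ {∞}) ∩ V(ℝ)` with respect to the multiplier norm
`‖b - c‖ = ‖W⁰(b) - W⁰(c)‖`. -/
def multiplierClosure : Set (ℝ → ℂ) :=
  {b | MemLp b ∞ volume ∧ ∃ B, ρ.IsFourierConvolution b B ∧
    ∀ ε : ℝ, 0 < ε → ∃ c ∈ continuousBV, ∃ C, ρ.IsFourierConvolution c C ∧ ‖B - C‖ < ε}

/-- The smallest Banach subalgebra of the algebra of bounded operators on `X(ℝ)` that contains
all `aI` with `a ∈ C(ℝ ∪ {∞})` and all `W⁰(b)` with `b ∈ C_X(ℝ ∪ {∞})`. -/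
def convolutionAlgebra : Subalgebra ℂ (ρ.Space →L[ℂ] ρ.Space) :=
  (Algebra.adjoin ℂ (Set.range ρ.mulOp ∪
    {T | ∃ b ∈ ρ.multiplierClosure, ρ.IsFourierConvolution b T})).topologicalClosure

end BanachFunctionNorm

end

/-! Two facts carry the proof: compact operators on $X$ are norm limits of finite-rank operators,
and every rank-one operator lies in the algebra.

For the first, let $P_n$ average $f$ over the cells of length $1/(n+1)$ inside $[-(n+1),n+1)$
(`averageOp`). Pointwise $|P_nf|\le Mf$, so the $P_n$ are uniformly bounded. They converge to the
identity on $C_c$, hence strongly on $X$, and therefore $P_nK\to K$ in norm for compact $K$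
(`IsCompactOperator.tendsto_comp`). Each $P_nK$ has finite rank.

For the second, let $u,v\in C_c$ and let $k\in C_c^\infty$ equal 1 on all differences $x-t$ with
$x\in\operatorname{supp}v$, $t\in\operatorname{supp}u$. The operator $vI\cdot(k*)\cdot uI$ has
kernel $v(x)k(x-t)u(t)=v(x)u(t)$, so it is $f\mapsto(\int uf)\,v$. Convolution by $k$ is bounded
because $|f*k|\le C\,Mf$, and its symbol is a Schwartz function, hence continuous on $\dot{\mathbb
R}$ and of bounded variation. General rank-one operators follow because $C_c$ is dense in $X$ and in
$X^*$; both densities come from reflexivity. -/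

noncomputable section

/-! ### Hahn–Banach density criterion. -/

/-- A subspace whose annihilator is trivial is dense. -/
theorem Submodule.topologicalClosure_eq_top_of_forall_dual {E : Type*} [NormedAddCommGroup E]
    [NormedSpace ℂ E] (p : Submodule ℂ E)
    (h : ∀ F : E →L[ℂ] ℂ, (∀ x ∈ p, F x = 0) → F = 0) : p.topologicalClosure = ⊤ := by
  let _ : NormedSpace ℝ E := NormedSpace.restrictScalars ℝ ℂ E
  rw [eq_top_iff]
  intro x _
  by_contra hx
  have hconv : Convex ℝ (p.topologicalClosure : Set E) :=
    (p.topologicalClosure.restrictScalars ℝ).convex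
  obtain ⟨F, u, hu, hb⟩ := RCLike.geometric_hahn_banach_point_closed (𝕜 := ℂ) hconv
    p.isClosed_topologicalClosure hx
  have hz : ∀ y ∈ p, F y = 0 := by
    intro y hy
    by_contra hne
    -- The real part of `F` exceeds `u` on the closure of `p`, but if `F y ≠ 0` some multiple of `y`
    -- has value `u - 1`.
    have h1 := hb (((u - 1 : ℝ) : ℂ) • (F y)⁻¹ • y)
      (p.le_topologicalClosure (p.smul_mem _ (p.smul_mem _ hy)))
    have h2 : F (((u - 1 : ℝ) : ℂ) • (F y)⁻¹ • y) = ((u - 1 : ℝ) : ℂ) := by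
      rw [map_smul, map_smul, smul_eq_mul, smul_eq_mul, inv_mul_cancel₀ hne, mul_one]
    rw [h2, RCLike.re_eq_complex_re, Complex.ofReal_re] at h1
    linarith
  have h0 := hb 0 (Submodule.zero_mem _)
  rw [h F hz] at hu h0
  simp at hu h0
  linarith

theorem norm_le_mul_norm_of_enorm_le {E F : Type*} [SeminormedAddCommGroup E]
    [SeminormedAddCommGroup F] {x : E} {y : F} {C : ℝ≥0} (h : ‖x‖ₑ ≤ C * ‖y‖ₑ) :
    ‖x‖ ≤ C * ‖y‖ := by
  rw [enorm_eq_nnnorm, enorm_eq_nnnorm] at h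
  exact_mod_cast h

/-! ### Elements of $X(\mathbb R)$ as functions, and the functionals $f\mapsto\int uf$. -/

namespace BanachFunctionNorm

variable {ρ : BanachFunctionNorm}

namespace Space

theorem enorm_def (f : ρ.Space) : ‖f‖ₑ = ρ.toFun fun x => ‖f.val x‖ₑ := by
  rw [← ofReal_norm, norm_def, ENNReal.ofReal_toReal f.eval_val_lt_top.ne]
  rfl

theorem ext_ae {f g : ρ.Space} (h : f.val =ᵐ[volume] g.val) : f = g :=
  val_injective (AEEqFun.ext h)

theorem enorm_le_of_ae {f : ρ.Space} {g : ℝ → ℝ≥0∞} (hg : AEMeasurable g volume)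
    (h : ∀ᵐ x, ‖f.val x‖ₑ ≤ g x) : ‖f‖ₑ ≤ ρ.toFun g := by
  rw [enorm_def]
  exact ρ.mono' _ _ hg (aemeasurable_enorm _) h

/-- The element of the space given by a measurable function. -/
def ofFun (f : ℝ → ℂ) (hf : AEStronglyMeasurable f volume)
    (h : ρ.toFun (fun x => ‖f x‖ₑ) < ∞) : ρ.Space :=
  (⟨AEEqFun.mk f hf, by
    change ρ.toFun _ < ∞
    rwa [ρ.toFun_congr (aemeasurable_enorm _) (g := fun x => ‖f x‖ₑ)]
    filter_upwards [AEEqFun.coeFn_mk f hf] with x hx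
    rw [hx]⟩ : ρ.submodule)

theorem coeFn_ofFun (f : ℝ → ℂ) (hf : AEStronglyMeasurable f volume)
    (h : ρ.toFun (fun x => ‖f x‖ₑ) < ∞) : (ofFun f hf h).val =ᵐ[volume] f :=
  AEEqFun.coeFn_mk f hf

theorem coeFn_add (f g : ρ.Space) : (f + g).val =ᵐ[volume] fun x => f.val x + g.val x :=
  AEEqFun.coeFn_add f.val g.val

theorem coeFn_smul (c : ℂ) (f : ρ.Space) : (c • f).val =ᵐ[volume] fun x => c * f.val x :=
  AEEqFun.coeFn_smul c f.val

theorem coeFn_sub (f g : ρ.Space) : (f - g).val =ᵐ[volume] fun x => f.val x - g.val x :=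
  AEEqFun.coeFn_sub f.val g.val

theorem coeFn_zero : (0 : ρ.Space).val =ᵐ[volume] fun _ => 0 :=
  AEEqFun.coeFn_zero

theorem coeFn_sum {ι : Type*} (s : Finset ι) (f : ι → ρ.Space) :
    (∑ i ∈ s, f i).val =ᵐ[volume] fun x => ∑ i ∈ s, (f i).val x := by
  classical
  induction s using Finset.induction_on with
  | empty => simpa using coeFn_zero
  | insert i s hi ih =>
    rw [Finset.sum_insert hi]
    filter_upwards [coeFn_add (f i) (∑ i ∈ s, f i), ih] with x h1 h2
    rw [h1, h2, Finset.sum_insert hi]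

theorem coeFn_mulOp (a : C(OnePoint ℝ, ℂ)) (f : ρ.Space) :
    (ρ.mulOp a f).val =ᵐ[volume] fun x => a (x : OnePoint ℝ) * f.val x := by
  filter_upwards [AEEqFun.coeFn_mul (symbolClass a) f.val, AEEqFun.coeFn_mk
    (fun x : ℝ => a (x : OnePoint ℝ))
    (a.continuous.comp OnePoint.continuous_coe).aestronglyMeasurable] with x hx hx'
  exact hx.trans (congrArg (· * f.val x) hx')

theorem setLIntegral_enorm_le (E : Set ℝ) (hE : MeasurableSet E) (hfin : volume E < ∞) :
    ∃ C : ℝ≥0, ∀ f : ρ.Space, ∫⁻ x in E, ‖f.val x‖ₑ ≤ C * ‖f‖ₑ := by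
  obtain ⟨C, hC⟩ := ρ.lintegral_le' E hE.nullMeasurableSet hfin
  exact ⟨C, fun f => (hC _ (aemeasurable_enorm _)).trans_eq (by rw [enorm_def])⟩

/-- This is the axiom $\int_E f\le C_E\,\rho(f)$ on compact sets. It makes pairings with test
functions and convolutions with compactly supported kernels meaningful. -/
theorem locallyIntegrable (f : ρ.Space) : LocallyIntegrable f.val volume := by
  rw [locallyIntegrable_iff]
  intro k hk
  refine ⟨f.val.aestronglyMeasurable.restrict, ?_⟩
  obtain ⟨C, hC⟩ := setLIntegral_enorm_le (ρ := ρ) k hk.measurableSet hk.measure_lt_top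
  exact (hC f).trans_lt (ENNReal.mul_lt_top ENNReal.coe_lt_top enorm_lt_top)

end Space

/-- A bounded measurable function that vanishes off a bounded interval. -/
structure IsBoundedSupported (u : ℝ → ℂ) : Prop where
  meas : AEStronglyMeasurable u volume
  bound : ∃ C R : ℝ≥0, ∀ x, ‖u x‖ₑ ≤ (Set.Icc (-R : ℝ) R).indicator (fun _ => (C : ℝ≥0∞)) x

theorem toFun_indicator_const (E : Set ℝ) (hE : MeasurableSet E) (C : ℝ≥0) :
    ρ.toFun (E.indicator fun _ => (C : ℝ≥0∞)) = C * ρ.toFun (E.indicator fun _ => 1) := by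
  rw [← ρ.smul' C _ (aemeasurable_indicator_one hE.nullMeasurableSet)]
  congr 1
  ext x
  by_cases hx : x ∈ E <;> simp [hx]

theorem toFun_indicator_const_lt_top (a b : ℝ) (C : ℝ≥0) :
    ρ.toFun ((Set.Icc a b).indicator fun _ => (C : ℝ≥0∞)) < ∞ := by
  rw [toFun_indicator_const _ measurableSet_Icc]
  exact ENNReal.mul_lt_top ENNReal.coe_lt_top
    (ρ.indicator_lt_top' _ measurableSet_Icc.nullMeasurableSet (by simp))

theorem aemeasurable_indicator_const (a b : ℝ) (C : ℝ≥0∞) :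
    AEMeasurable ((Set.Icc a b).indicator fun _ => C) volume :=
  aemeasurable_const.indicator measurableSet_Icc

theorem _root_.HasCompactSupport.exists_subset_Icc {u : ℝ → ℂ} (hs : HasCompactSupport u) :
    ∃ R : ℝ≥0, ∀ x, x ∉ Set.Icc (-R : ℝ) R → u x = 0 := by
  obtain ⟨R, hR⟩ := hs.isBounded.subset_closedBall (0 : ℝ)
  refine ⟨R.toNNReal, fun x hx => image_eq_zero_of_notMem_tsupport fun h => hx ?_⟩
  have h1 := hR h
  rw [Metric.mem_closedBall, dist_zero_right, Real.norm_eq_abs] at h1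
  exact abs_le.1 (h1.trans (Real.le_coe_toNNReal R))

theorem IsBoundedSupported.of_continuous {u : ℝ → ℂ} (hc : Continuous u)
    (hs : HasCompactSupport u) : IsBoundedSupported u := by
  obtain ⟨R, hR⟩ := hs.exists_subset_Icc
  obtain ⟨C, hC⟩ := hs.exists_bound_of_continuous hc
  refine ⟨hc.aestronglyMeasurable, C.toNNReal, R, fun x => ?_⟩
  by_cases hx : x ∈ Set.Icc (-R : ℝ) R
  · rw [Set.indicator_of_mem hx, ← ofReal_norm]
    exact ENNReal.ofReal_le_ofReal (hC x)
  · simp [hR x hx]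

theorem IsBoundedSupported.indicator_Ico (a b : ℝ) :
    IsBoundedSupported ((Set.Ico a b).indicator fun _ => 1) := by
  refine ⟨aestronglyMeasurable_const.indicator measurableSet_Ico, 1, ⟨|a| + |b|, by positivity⟩,
    fun x => ?_⟩
  by_cases hx : x ∈ Set.Ico a b
  · rw [Set.indicator_of_mem hx, Set.indicator_of_mem]
    · simp
    · have h1 := neg_abs_le a
      have h2 := le_abs_self b
      have h3 := abs_nonneg a
      have h4 := abs_nonneg b
      have h5 := hx.1
      have h6 := hx.2
      change -(|a| + |b|) ≤ x ∧ x ≤ |a| + |b|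
      constructor <;> linarith
  · simp [hx]

namespace IsBoundedSupported

variable {u : ℝ → ℂ} (hu : IsBoundedSupported u)
include hu

theorem toFun_lt_top : ρ.toFun (fun x => ‖u x‖ₑ) < ∞ := by
  obtain ⟨C, R, h⟩ := hu.bound
  exact (ρ.mono' _ _ (aemeasurable_indicator_const _ _ _) hu.meas.enorm
    (ae_of_all _ h)).trans_lt (toFun_indicator_const_lt_top _ _ _)

theorem exists_lintegral_mul_le :
    ∃ C : ℝ≥0, ∀ f : ρ.Space, ∫⁻ x, ‖u x * f.val x‖ₑ ≤ C * ‖f‖ₑ := by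
  obtain ⟨C, R, h⟩ := hu.bound
  obtain ⟨D, hD⟩ := Space.setLIntegral_enorm_le (ρ := ρ) (Set.Icc (-R : ℝ) R) measurableSet_Icc
    (by simp)
  refine ⟨C * D, fun f => ?_⟩
  calc ∫⁻ x, ‖u x * f.val x‖ₑ
      ≤ ∫⁻ x, (C : ℝ≥0∞) * (Set.Icc (-R : ℝ) R).indicator (fun x => ‖f.val x‖ₑ) x := by
        refine lintegral_mono fun x => ?_
        rw [enorm_mul]
        refine (mul_le_mul_left (h x) _).trans ?_
        by_cases hx : x ∈ Set.Icc (-R : ℝ) R <;> simp [hx]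
    _ = C * ∫⁻ x in Set.Icc (-R : ℝ) R, ‖f.val x‖ₑ := by
        rw [lintegral_const_mul' _ _ ENNReal.coe_ne_top, lintegral_indicator measurableSet_Icc]
    _ ≤ C * (D * ‖f‖ₑ) := by gcongr; exact hD f
    _ = _ := by push_cast; ring

theorem integrable_mul (f : ρ.Space) : Integrable (fun x => u x * f.val x) volume := by
  obtain ⟨C, hC⟩ := hu.exists_lintegral_mul_le (ρ := ρ)
  exact ⟨hu.meas.mul f.val.aestronglyMeasurable,
    (hC f).trans_lt (ENNReal.mul_lt_top ENNReal.coe_lt_top enorm_lt_top)⟩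

/-- The functional `f ↦ ∫ u f`. -/
def pairing : ρ.Space →L[ℂ] ℂ :=
  LinearMap.mkContinuousOfExistsBound
    { toFun := fun f => ∫ x, u x * f.val x
      map_add' := fun f g => by
        rw [← integral_add (hu.integrable_mul f) (hu.integrable_mul g)]
        refine integral_congr_ae ?_
        filter_upwards [Space.coeFn_add f g] with x hx
        rw [hx, mul_add]
      map_smul' := fun c f => by
        rw [RingHom.id_apply, smul_eq_mul, ← integral_const_mul]
        refine integral_congr_ae ?_
        filter_upwards [Space.coeFn_smul c f] with x hx
        rw [hx]
        ring }
    (by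
      obtain ⟨C, hC⟩ := hu.exists_lintegral_mul_le (ρ := ρ)
      refine ⟨C, fun f => ?_⟩
      exact norm_le_mul_norm_of_enorm_le ((enorm_integral_le_lintegral_enorm _).trans (hC f)))

theorem pairing_apply (f : ρ.Space) : hu.pairing f = ∫ x, u x * f.val x := rfl

/-- The element of the space given by `u`. -/
def toSpace : ρ.Space := Space.ofFun u hu.meas hu.toFun_lt_top

theorem coeFn_toSpace : (hu.toSpace : ρ.Space).val =ᵐ[volume] u := Space.coeFn_ofFun _ _ _

end IsBoundedSupported

/-! ### Density of the continuous functions with compact support -/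

/-- In the dual of a reflexive space, the functionals given by continuous functions with compact
support span a dense subspace. -/
theorem IsReflexive.span_pairing_dense (hrefl : ρ.IsReflexive) :
    (Submodule.span ℂ {ψ : ρ.Space →L[ℂ] ℂ | ∃ (u : ℝ → ℂ) (hc : Continuous u)
      (hs : HasCompactSupport u), ψ = (IsBoundedSupported.of_continuous hc hs).pairing}
        ).topologicalClosure = ⊤ := by
  refine Submodule.topologicalClosure_eq_top_of_forall_dual _ fun F hF => ?_
  -- By reflexivity a functional on the dual is evaluation at some `f`; annihilating all pairings
  -- then means that `f` is orthogonal to every test function.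
  obtain ⟨f, rfl⟩ := hrefl F
  have h0 : ∀ᵐ x, f.val x = 0 := by
    refine ae_eq_zero_of_integral_contDiff_smul_eq_zero f.locallyIntegrable fun g hg hs => ?_
    have hc : Continuous fun x => (g x : ℂ) := Complex.continuous_ofReal.comp hg.continuous
    have hs' : HasCompactSupport fun x => (g x : ℂ) := hs.comp_left (g := fun r : ℝ => (r : ℂ)) rfl
    have h1 := hF _ (Submodule.subset_span ⟨_, hc, hs', rfl⟩)
    simpa [NormedSpace.inclusionInDoubleDual, IsBoundedSupported.pairing_apply] using h1
  have : f = 0 := Space.ext_ae (by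
    filter_upwards [h0, Space.coeFn_zero (ρ := ρ)] with x h1 h2
    rw [h1, h2])
  rw [this, map_zero]

/-- A functional on a reflexive space that vanishes along a bounded sequence vanishes at the
limit, when the sequence converges in the sense of integrals against `C_c`. -/
theorem IsReflexive.eq_zero_of_tendsto (hrefl : ρ.IsReflexive) (ψ : ρ.Space →L[ℂ] ℂ)
    (f : ρ.Space) (g : ℕ → ρ.Space) (B : ℝ) (hB : ∀ n, ‖g n‖ ≤ B) (h0 : ∀ n, ψ (g n) = 0)
    (h : ∀ (u : ℝ → ℂ), Continuous u → HasCompactSupport u →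
      Tendsto (fun n => ∫ x, u x * (g n).val x) atTop (𝓝 (∫ x, u x * f.val x))) : ψ f = 0 := by
  -- The functionals that converge along the sequence; they contain the span of the pairings, which
  -- is dense in the dual.
  let p : Submodule ℂ (ρ.Space →L[ℂ] ℂ) :=
    { carrier := {φ | Tendsto (fun n => φ (g n)) atTop (𝓝 (φ f))}
      zero_mem' := by simp
      add_mem' := fun ha hb => Tendsto.add ha hb
      smul_mem' := fun c _ ha => Tendsto.const_smul ha c }
  have hp : ∀ φ ∈ p, Tendsto (fun n => φ (g n)) atTop (𝓝 (φ f)) := fun φ hφ => hφ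
  have hle : Submodule.span ℂ {ψ : ρ.Space →L[ℂ] ℂ | ∃ (u : ℝ → ℂ) (hc : Continuous u)
      (hs : HasCompactSupport u), ψ = (IsBoundedSupported.of_continuous hc hs).pairing} ≤ p := by
    rw [Submodule.span_le]
    rintro _ ⟨u, hc, hs, rfl⟩
    exact h u hc hs
  have hB0 : 0 ≤ B := (norm_nonneg _).trans (hB 0)
  have key : ∀ ε > 0, ‖ψ f‖ ≤ ε * (B + ‖f‖) := by
    intro ε hε
    have hψ : ψ ∈ (Submodule.span ℂ {ψ : ρ.Space →L[ℂ] ℂ | ∃ (u : ℝ → ℂ) (hc : Continuous u)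
      (hs : HasCompactSupport u), ψ = (IsBoundedSupported.of_continuous hc hs).pairing}
        ).topologicalClosure := by rw [hrefl.span_pairing_dense]; trivial
    -- Since `ψ (g n) = 0`, a nearby `φ` is uniformly small on the bounded sequence, hence also at
    -- its limit `f`.
    obtain ⟨φ, hφ, hd⟩ := Metric.mem_closure_iff.1 hψ ε hε
    rw [dist_eq_norm] at hd
    have hb : ∀ n, ‖φ (g n)‖ ≤ ε * B := fun n => by
      have : φ (g n) = -((ψ - φ) (g n)) := by simp [h0 n]
      rw [this, norm_neg]
      exact (ContinuousLinearMap.le_opNorm _ _).trans (by gcongr; exact hB n)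
    have hφf : ‖φ f‖ ≤ ε * B := le_of_tendsto' (hp φ (hle hφ)).norm hb
    calc ‖ψ f‖ = ‖(ψ - φ) f + φ f‖ := by simp
      _ ≤ ε * ‖f‖ + ε * B := (norm_add_le _ _).trans
        (add_le_add ((ContinuousLinearMap.le_opNorm _ _).trans (by gcongr)) hφf)
      _ = _ := by ring
  by_contra hne
  have hpos : 0 < ‖ψ f‖ := norm_pos_iff.2 hne
  -- This `ε` makes the bound at most `‖ψ f‖ / 2`; the `+ 1` keeps the denominator positive.
  have h1 := key (‖ψ f‖ / (2 * (B + ‖f‖ + 1))) (by positivity)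
  have h2 : ‖ψ f‖ / (2 * (B + ‖f‖ + 1)) * (B + ‖f‖) ≤ ‖ψ f‖ / 2 := by
    rw [div_mul_eq_mul_div, div_le_div_iff₀ (by positivity) (by positivity)]
    nlinarith
  linarith

end BanachFunctionNorm

namespace BanachFunctionNorm

variable {ρ : BanachFunctionNorm}

/-- A bounded measurable function with bounded support is the almost everywhere limit of a
uniformly bounded sequence of continuous functions with uniformly bounded supports. -/
theorem IsBoundedSupported.exists_continuous_tendsto {u : ℝ → ℂ} (hu : IsBoundedSupported u) :
    ∃ v : ℕ → ℝ → ℂ, (∀ n, Continuous (v n)) ∧ (∀ n, HasCompactSupport (v n)) ∧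
      (∃ C R : ℝ≥0, ∀ n x,
        ‖v n x‖ₑ ≤ (Set.Icc (-R : ℝ) R).indicator (fun _ => (C : ℝ≥0∞)) x) ∧
      ∀ᵐ x, Tendsto (fun n => v n x) atTop (𝓝 (u x)) := by
  obtain ⟨C, R, hb⟩ := hu.bound
  have hC : ∀ x, ‖u x‖ ≤ C := fun x => by
    have h1 : ‖u x‖ₑ ≤ C := (hb x).trans (Set.indicator_le_self _ _ x)
    rw [enorm_eq_nnnorm] at h1
    exact_mod_cast h1
  have hR : ∀ x, x ∉ Set.Icc (-R : ℝ) R → u x = 0 := fun x hx => by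
    have h1 := hb x
    rw [Set.indicator_of_notMem hx] at h1
    simpa using h1
  have hcs : HasCompactSupport u := HasCompactSupport.intro isCompact_Icc hR
  have hint : Integrable u volume := by
    refine ⟨hu.meas, ?_⟩
    refine (lintegral_mono hb).trans_lt ?_
    rw [lintegral_indicator measurableSet_Icc, lintegral_const]
    exact ENNReal.mul_lt_top ENNReal.coe_lt_top (by simp)
  -- Mollifiers with outer radius $1/(n+1)\le1$, so that supports grow by at most 1. The ratio 2 of
  -- outer to inner radius is the constant `K` required for almost everywhere convergence.
  let φ : ℕ → ContDiffBump (0 : ℝ) := fun n =>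
    ⟨1 / (2 * ((n : ℝ) + 1)), 1 / ((n : ℝ) + 1), by positivity, by
      refine one_div_lt_one_div_of_lt (by positivity) ?_
      linarith [(Nat.cast_nonneg n : (0 : ℝ) ≤ n)]⟩
  have hsupp : ∀ n, Function.support ((φ n).normed volume) ⊆ Metric.ball 0 1 := fun n => by
    rw [(φ n).support_normed_eq]
    refine Metric.ball_subset_ball ?_
    change 1 / ((n : ℝ) + 1) ≤ 1
    rw [div_le_one (by positivity)]
    linarith [(Nat.cast_nonneg n : (0 : ℝ) ≤ n)]
  refine ⟨fun n => convolution ((φ n).normed volume) u (ContinuousLinearMap.lsmul ℝ ℝ) volume,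
    fun n => ?_, fun n => ?_, ⟨C, R + 1, fun n x => ?_⟩, ?_⟩
  · exact (φ n).hasCompactSupport_normed.continuous_convolution_left _
      (φ n).continuous_normed hint.locallyIntegrable
  · exact HasCompactSupport.convolution _ (φ n).hasCompactSupport_normed hcs
  · by_cases hx : x ∈ Set.Icc (-((R + 1 : ℝ≥0) : ℝ)) ((R + 1 : ℝ≥0) : ℝ)
    · rw [Set.indicator_of_mem hx, enorm_eq_nnnorm]
      have h1 := dist_convolution_le (x₀ := x) (z₀ := 0) (μ := volume) C.2 (hsupp n)
        (φ n).nonneg_normed ((φ n).integral_normed) hu.meas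
        (fun y _ => by rw [dist_zero_right]; exact hC y)
      rw [dist_zero_right] at h1
      exact_mod_cast h1
    · have h1 := dist_convolution_le (x₀ := x) (z₀ := 0) (μ := volume) le_rfl (hsupp n)
        (φ n).nonneg_normed ((φ n).integral_normed) hu.meas
        (fun y hy => by
          rw [dist_zero_right, hR y, norm_zero]
          contrapose! hx
          rw [Metric.mem_ball, Real.dist_eq, abs_lt] at hy
          push_cast
          constructor <;> linarith [hx.1, hx.2, hy.1, hy.2])
      rw [dist_zero_right, norm_le_zero_iff] at h1
      simp [h1]
  · refine ContDiffBump.ae_convolution_tendsto_right_of_locallyIntegrable (K := 2)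
      tendsto_one_div_add_atTop_nhds_zero_nat (Eventually.of_forall fun n => ?_)
      hint.locallyIntegrable
    change 1 / ((n : ℝ) + 1) ≤ 2 * (1 / (2 * ((n : ℝ) + 1)))
    field_simp
    exact le_rfl

theorem Space.norm_le_of_bound {f : ρ.Space} {C R : ℝ≥0}
    (h : ∀ᵐ x, ‖f.val x‖ₑ ≤ (Set.Icc (-R : ℝ) R).indicator (fun _ => (C : ℝ≥0∞)) x) :
    ‖f‖ ≤ (C : ℝ) * (ρ.toFun ((Set.Icc (-R : ℝ) R).indicator fun _ => 1)).toReal := by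
  have h1 := Space.enorm_le_of_ae (aemeasurable_indicator_const _ _ _) h
  rw [toFun_indicator_const _ measurableSet_Icc] at h1
  rw [← toReal_enorm, ← ENNReal.coe_toReal, ← ENNReal.toReal_mul]
  exact ENNReal.toReal_mono (ENNReal.mul_lt_top ENNReal.coe_lt_top
    (by simpa using toFun_indicator_const_lt_top (ρ := ρ) (-R) R 1)).ne h1

theorem Space.norm_le_of_enorm_le_ae {f g : ρ.Space} (h : ∀ᵐ x, ‖f.val x‖ₑ ≤ ‖g.val x‖ₑ) :
    ‖f‖ ≤ ‖g‖ := by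
  have h1 := Space.enorm_le_of_ae (aemeasurable_enorm _) h
  rw [← enorm_def] at h1
  simpa using norm_le_mul_norm_of_enorm_le (C := 1) (by simpa using h1)

/-- In a reflexive space, the continuous functions with compact support span a dense
subspace. -/
theorem IsReflexive.span_toSpace_dense (hrefl : ρ.IsReflexive) :
    (Submodule.span ℂ {g : ρ.Space | ∃ (u : ℝ → ℂ) (hc : Continuous u)
      (hs : HasCompactSupport u), g = (IsBoundedSupported.of_continuous hc hs).toSpace}
        ).topologicalClosure = ⊤ := by
  refine Submodule.topologicalClosure_eq_top_of_forall_dual _ fun ψ hψ => ?_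
  have hcont : ∀ (u : ℝ → ℂ) (hc : Continuous u) (hs : HasCompactSupport u),
      ψ (IsBoundedSupported.of_continuous hc hs).toSpace = 0 := fun u hc hs =>
    hψ _ (Submodule.subset_span ⟨u, hc, hs, rfl⟩)
  -- Mollifications are bounded in $X$ by their common bound and support, and converge against $C_c$
  -- by dominated convergence.
  have hbdd : ∀ (u : ℝ → ℂ) (hu : IsBoundedSupported u), ψ hu.toSpace = 0 := by
    intro u hu
    obtain ⟨v, hvc, hvs, ⟨C, R, hb⟩, hlim⟩ := hu.exists_continuous_tendsto
    refine hrefl.eq_zero_of_tendsto ψ _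
      (fun n => (IsBoundedSupported.of_continuous (hvc n) (hvs n)).toSpace)
      ((C : ℝ) * (ρ.toFun ((Set.Icc (-R : ℝ) R).indicator fun _ => 1)).toReal)
      (fun n => Space.norm_le_of_bound ?_) (fun n => hcont _ (hvc n) (hvs n)) fun w hwc hws => ?_
    · filter_upwards [(IsBoundedSupported.of_continuous (hvc n) (hvs n)).coeFn_toSpace (ρ := ρ)]
        with x hx
      rw [hx]
      exact hb n x
    · have h1 : ∀ n, ∫ x, w x * ((IsBoundedSupported.of_continuous (hvc n)
          (hvs n)).toSpace : ρ.Space).val x = ∫ x, w x * v n x := fun n => by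
        refine integral_congr_ae ?_
        filter_upwards [(IsBoundedSupported.of_continuous (hvc n) (hvs n)).coeFn_toSpace (ρ := ρ)]
          with x hx
        rw [hx]
      have h2 : ∫ x, w x * (hu.toSpace : ρ.Space).val x = ∫ x, w x * u x := by
        refine integral_congr_ae ?_
        filter_upwards [hu.coeFn_toSpace (ρ := ρ)] with x hx
        rw [hx]
      simp only [h1, h2]
      refine tendsto_integral_of_dominated_convergence (fun x => ‖w x‖ * C)
        (fun n => (hwc.mul (hvc n)).aestronglyMeasurable)
        ((hwc.integrable_of_hasCompactSupport hws).norm.mul_const _)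
        (fun n => ae_of_all _ fun x => ?_) ?_
      · rw [norm_mul]
        gcongr
        have h3 := (hb n x).trans (Set.indicator_le_self _ _ x)
        rw [enorm_eq_nnnorm] at h3
        exact_mod_cast h3
      · filter_upwards [hlim] with x hx
        exact hx.const_mul _
  ext f
  change ψ f = 0
  have hmeas : ∀ n : ℕ, MeasurableSet (Set.Icc (-(n : ℝ)) n ∩ {x | ‖f.val x‖ ≤ n}) := fun n =>
    measurableSet_Icc.inter
      (measurableSet_le f.val.stronglyMeasurable.norm.measurable measurable_const)
  -- Truncation of `f` in both height and support, so that $|t_n|\le|f|$ and $t_n\to f$ pointwise.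
  let t : ℕ → ℝ → ℂ := fun n => (Set.Icc (-(n : ℝ)) n ∩ {x | ‖f.val x‖ ≤ n}).indicator f.val
  have htb : ∀ n x, ‖t n x‖ ≤ ‖f.val x‖ := fun n x => norm_indicator_le_norm_self _ _
  have ht : ∀ n, IsBoundedSupported (t n) := fun n => by
    refine ⟨f.val.aestronglyMeasurable.indicator (hmeas n), n, n, fun x => ?_⟩
    by_cases hx : x ∈ Set.Icc (-(n : ℝ)) n ∩ {x | ‖f.val x‖ ≤ n}
    · rw [Set.indicator_of_mem (by simpa using hx.1)]
      simp only [t, Set.indicator_of_mem hx]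
      rw [enorm_eq_nnnorm]
      exact_mod_cast hx.2
    · simp [t, Set.indicator_of_notMem hx]
  refine hrefl.eq_zero_of_tendsto ψ f (fun n => (ht n).toSpace) ‖f‖ (fun n => ?_)
    (fun n => hbdd _ _) fun w hwc hws => ?_
  · refine Space.norm_le_of_enorm_le_ae ?_
    filter_upwards [(ht n).coeFn_toSpace (ρ := ρ)] with x hx
    rw [hx]
    exact enorm_le_iff_norm_le.2 (htb n x)
  · have h1 : ∀ n, ∫ x, w x * ((ht n).toSpace : ρ.Space).val x = ∫ x, w x * t n x := fun n => by
      refine integral_congr_ae ?_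
      filter_upwards [(ht n).coeFn_toSpace (ρ := ρ)] with x hx
      rw [hx]
    simp only [h1]
    refine tendsto_integral_of_dominated_convergence (fun x => ‖w x * f.val x‖)
      (fun n => hwc.aestronglyMeasurable.mul (ht n).meas)
      ((IsBoundedSupported.of_continuous hwc hws).integrable_mul f).norm
      (fun n => ae_of_all _ fun x => ?_) (ae_of_all _ fun x => ?_)
    · rw [norm_mul, norm_mul]
      gcongr
      exact htb n x
    · refine Tendsto.const_mul _ (tendsto_const_nhds.congr' ?_)
      obtain ⟨N, hN⟩ := exists_nat_ge (max |x| ‖f.val x‖)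
      filter_upwards [eventually_ge_atTop N] with n hn
      have hn' : (N : ℝ) ≤ n := by exact_mod_cast hn
      refine (Set.indicator_of_mem ?_ _).symm
      exact ⟨abs_le.1 ((le_max_left _ _).trans (hN.trans hn')),
        (le_max_right _ _).trans (hN.trans hn')⟩

end BanachFunctionNorm

/-! ### The maximal function and the convolutions it dominates. -/

theorem le_maximalFunction {f : ℝ → ℝ≥0∞} {a b x : ℝ} (hab : a < b) (hx : x ∈ Set.Icc a b) :
    (∫⁻ y in Set.Icc a b, f y) / ENNReal.ofReal (b - a) ≤ maximalFunction f x := by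
  have h1 : ⨍⁻ y in Set.Icc a b, f y ∂volume ≤ maximalFunction f x :=
    le_iSup_of_le a (le_iSup_of_le b (le_iSup_of_le hab (le_iSup_of_le hx le_rfl)))
  rwa [setLAverage_eq, Real.volume_Icc] at h1

/-- An interval around `x` can be enlarged by `δ` on both sides at little cost in its average, and
then it serves all points near `x`. This supplies the measurability of the maximal function. -/
theorem lowerSemicontinuous_maximalFunction (f : ℝ → ℝ≥0∞) :
    LowerSemicontinuous (maximalFunction f) := by
  intro x c hc
  simp only [maximalFunction, lt_iSup_iff] at hc
  obtain ⟨a, b, hab, hx, hc⟩ := hc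
  rw [setLAverage_eq, Real.volume_Icc] at hc
  have hlim : Tendsto (fun δ : ℝ => (∫⁻ y in Set.Icc a b, f y) / ENNReal.ofReal (b + δ - (a - δ)))
      (𝓝[>] 0) (𝓝 ((∫⁻ y in Set.Icc a b, f y) / ENNReal.ofReal (b - a))) := by
    refine ENNReal.Tendsto.const_div (ENNReal.tendsto_ofReal ?_) (Or.inl ENNReal.ofReal_ne_top)
    have : Continuous fun δ : ℝ => b + δ - (a - δ) := by fun_prop
    simpa using (this.tendsto 0).mono_left nhdsWithin_le_nhds
  obtain ⟨δ, hδ, hδ0⟩ := ((hlim.eventually (lt_mem_nhds hc)).and self_mem_nhdsWithin).exists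
  have hδ0 : 0 < δ := hδ0
  filter_upwards [Ioo_mem_nhds (sub_lt_self x hδ0) (lt_add_of_pos_right x hδ0)] with y hy
  refine hδ.trans_le (le_trans ?_ (le_maximalFunction (a := a - δ) (b := b + δ) (by linarith)
    ⟨by linarith [hy.1, hx.1], by linarith [hy.2, hx.2]⟩))
  gcongr
  · linarith
  · linarith

namespace BanachFunctionNorm

variable {ρ : BanachFunctionNorm}

theorem MaximalBounded.exists_bound (hM : ρ.MaximalBounded) :
    ∃ D : ℝ≥0, ∀ (f : ρ.Space) (h : ℝ → ℝ≥0∞) (C : ℝ≥0), AEMeasurable h volume →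
      (∀ᵐ x, h x ≤ C * maximalFunction (fun y => ‖f.val y‖ₑ) x) →
        ρ.toFun h ≤ ((C * D : ℝ≥0) : ℝ≥0∞) * ‖f‖ₑ := by
  obtain ⟨D, hD⟩ := hM
  refine ⟨D, fun f h C hh hle => ?_⟩
  have hm : AEMeasurable (maximalFunction fun y => ‖f.val y‖ₑ) volume :=
    (lowerSemicontinuous_maximalFunction _).measurable.aemeasurable
  refine (ρ.mono' _ _ (hm.const_mul (C : ℝ≥0∞)) hh hle).trans ?_
  rw [ρ.smul' C _ hm, ENNReal.coe_mul, mul_assoc, Space.enorm_def]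
  gcongr
  exact hD f

theorem exists_enorm_convolution_le {k : ℝ → ℂ} (hc : Continuous k) (hs : HasCompactSupport k) :
    ∃ C : ℝ≥0, ∀ (f : ℝ → ℂ) (x : ℝ),
      ‖convolution f k (ContinuousLinearMap.mul ℂ ℂ) volume x‖ₑ
        ≤ C * maximalFunction (fun y => ‖f y‖ₑ) x := by
  obtain ⟨C, R, h⟩ := (IsBoundedSupported.of_continuous hc hs).bound
  -- A bound for $|k|$ times the length of $[x-R-1,x+R+1]$; the extra 1 keeps the length positive
  -- when `R = 0`.
  refine ⟨C * (2 * (R + 1)), fun f x => ?_⟩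
  have hlen : x + (R + 1) - (x - (R + 1)) = ((2 * (R + 1) : ℝ≥0) : ℝ) := by
    push_cast
    ring
  have h0 : ((2 * (R + 1) : ℝ≥0) : ℝ≥0∞) ≠ 0 := by
    rw [ENNReal.coe_ne_zero]
    positivity
  calc ‖convolution f k (ContinuousLinearMap.mul ℂ ℂ) volume x‖ₑ
      ≤ ∫⁻ t, ‖f t * k (x - t)‖ₑ := enorm_integral_le_lintegral_enorm _
    _ ≤ ∫⁻ t, (C : ℝ≥0∞) * (Set.Icc (x - (R + 1)) (x + (R + 1))).indicator
          (fun t => ‖f t‖ₑ) t := by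
        refine lintegral_mono fun t => ?_
        rw [enorm_mul, mul_comm]
        by_cases ht : t ∈ Set.Icc (x - (R + 1)) (x + (R + 1))
        · rw [Set.indicator_of_mem ht]
          gcongr
          exact (h _).trans (Set.indicator_le_self _ _ _)
        · have h1 := h (x - t)
          rw [Set.indicator_of_notMem] at h1
          · rw [nonpos_iff_eq_zero.1 h1, zero_mul]
            exact zero_le
          · contrapose! ht
            exact ⟨by linarith [ht.2], by linarith [ht.1]⟩
    _ = C * ∫⁻ t in Set.Icc (x - (R + 1)) (x + (R + 1)), ‖f t‖ₑ := by
        rw [lintegral_const_mul' _ _ ENNReal.coe_ne_top, lintegral_indicator measurableSet_Icc]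
    _ = ((C * (2 * (R + 1)) : ℝ≥0) : ℝ≥0∞) *
          ((∫⁻ t in Set.Icc (x - (R + 1)) (x + (R + 1)), ‖f t‖ₑ) /
            ENNReal.ofReal (x + (R + 1) - (x - (R + 1)))) := by
        rw [hlen, ENNReal.ofReal_coe_nnreal, ENNReal.coe_mul, mul_assoc,
          ENNReal.mul_div_cancel h0 ENNReal.coe_ne_top]
    _ ≤ _ := by
        gcongr
        have hR : (0 : ℝ) ≤ R := R.2
        exact le_maximalFunction (by linarith) ⟨by linarith, by linarith⟩

theorem Space.continuous_convolution (f : ρ.Space) {k : ℝ → ℂ} (hc : Continuous k)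
    (hs : HasCompactSupport k) :
    Continuous (convolution f.val k (ContinuousLinearMap.mul ℂ ℂ) volume) :=
  hs.continuous_convolution_right _ f.locallyIntegrable hc

/-- Pointwise domination of $f*k$ by a multiple of $Mf$ yields both membership in $X$ and the norm
bound. -/
theorem MaximalBounded.exists_convolution (hM : ρ.MaximalBounded) {k : ℝ → ℂ}
    (hc : Continuous k) (hs : HasCompactSupport k) :
    ∃ W : ρ.Space →L[ℂ] ρ.Space, ∀ f : ρ.Space,
      (W f).val =ᵐ[volume] convolution f.val k (ContinuousLinearMap.mul ℂ ℂ) volume := by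
  obtain ⟨D, hD⟩ := hM.exists_bound
  obtain ⟨C, hC⟩ := exists_enorm_convolution_le hc hs
  have hb : ∀ f : ρ.Space, ρ.toFun (fun x => ‖convolution f.val k (ContinuousLinearMap.mul ℂ ℂ)
      volume x‖ₑ) ≤ ((C * D : ℝ≥0) : ℝ≥0∞) * ‖f‖ₑ := fun f =>
    hD f _ C (f.continuous_convolution hc hs).aestronglyMeasurable.enorm (ae_of_all _ (hC _))
  have hex : ∀ f : ρ.Space, ConvolutionExists f.val k (ContinuousLinearMap.mul ℂ ℂ) volume :=
    fun f => hs.convolutionExists_right _ f.locallyIntegrable hc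
  let w : ρ.Space → ρ.Space := fun f => Space.ofFun _
    (f.continuous_convolution hc hs).aestronglyMeasurable
    ((hb f).trans_lt (ENNReal.mul_lt_top ENNReal.coe_lt_top enorm_lt_top))
  have hw : ∀ f, (w f).val =ᵐ[volume] convolution f.val k (ContinuousLinearMap.mul ℂ ℂ) volume :=
    fun f => Space.coeFn_ofFun _ _ _
  refine ⟨LinearMap.mkContinuous
    { toFun := w
      map_add' := fun f g => ?_
      map_smul' := fun c f => ?_ } ((C * D : ℝ≥0) : ℝ) fun f => ?_, hw⟩
  · refine Space.ext_ae ?_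
    filter_upwards [hw (f + g), hw f, hw g, Space.coeFn_add (w f) (w g)] with x h1 h2 h3 h4
    rw [h1, h4, h2, h3, ← (hex f x).add_distrib (hex g x),
      convolution_congr _ (Space.coeFn_add f g) (ae_eq_refl k)]
    rfl
  · refine Space.ext_ae ?_
    filter_upwards [hw (c • f), hw f, Space.coeFn_smul c (w f)] with x h1 h2 h3
    rw [RingHom.id_apply, h1, h3, h2, convolution_congr _ (Space.coeFn_smul c f) (ae_eq_refl k)]
    simp only [convolution_def, ContinuousLinearMap.mul_apply', mul_assoc, integral_const_mul]
  · refine norm_le_mul_norm_of_enorm_le ?_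
    change ‖w f‖ₑ ≤ _
    rw [Space.enorm_def, ρ.toFun_congr (aemeasurable_enorm _)
      (g := fun x => ‖convolution f.val k (ContinuousLinearMap.mul ℂ ℂ) volume x‖ₑ)]
    · exact hb f
    · filter_upwards [hw f] with x hx
      rw [hx]

end BanachFunctionNorm

/-! ### Schwartz symbols and the convolution theorem. -/

open scoped FourierTransform SchwartzMap

/-- Each increment is the integral of the derivative, so the total variation is at most
$\int|b'|<\infty$. -/
theorem SchwartzMap.boundedVariationOn (b : 𝓢(ℝ, ℂ)) : BoundedVariationOn b Set.univ := by
  have hd : ∀ x, HasDerivAt b (SchwartzMap.derivCLM ℂ ℂ b x) x := fun x => by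
    rw [SchwartzMap.derivCLM_apply]
    exact b.differentiableAt.hasDerivAt
  have hi : Integrable (SchwartzMap.derivCLM ℂ ℂ b) volume := SchwartzMap.integrable _
  refine ne_top_of_le_ne_top
    (ENNReal.ofReal_ne_top (r := ∫ x, ‖SchwartzMap.derivCLM ℂ ℂ b x‖)) (iSup_le ?_)
  rintro ⟨n, u, hu, -⟩
  have hstep : ∀ i, dist (b (u (i + 1))) (b (u i))
      ≤ ∫ x in u i..u (i + 1), ‖SchwartzMap.derivCLM ℂ ℂ b x‖ := fun i => by
    rw [dist_eq_norm, ← intervalIntegral.integral_eq_sub_of_hasDerivAt (fun x _ => hd x)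
      hi.intervalIntegrable]
    exact intervalIntegral.norm_integral_le_integral_norm (hu (Nat.le_succ i))
  calc ∑ i ∈ Finset.range n, edist (b (u (i + 1))) (b (u i))
      = ENNReal.ofReal (∑ i ∈ Finset.range n, dist (b (u (i + 1))) (b (u i))) := by
        rw [ENNReal.ofReal_sum_of_nonneg fun _ _ => dist_nonneg]
        exact Finset.sum_congr rfl fun _ _ => edist_dist _ _
    _ ≤ _ := by
        refine ENNReal.ofReal_le_ofReal ((Finset.sum_le_sum fun i _ => hstep i).trans ?_)
        rw [intervalIntegral.sum_integral_adjacent_intervals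
          fun _ _ => hi.norm.intervalIntegrable,
          intervalIntegral.integral_of_le (hu (Nat.zero_le n))]
        exact setIntegral_le_integral hi.norm (ae_of_all _ fun _ => norm_nonneg _)

theorem SchwartzMap.mem_continuousBV (b : 𝓢(ℝ, ℂ)) :
    (b : ℝ → ℂ) ∈ BanachFunctionNorm.continuousBV := by
  refine ⟨⟨OnePoint.continuousMapMk ⟨b, b.continuous⟩ 0 ?_, fun x => rfl⟩, b.boundedVariationOn⟩
  rw [coclosedCompact_eq_cocompact]
  exact b.tendsto_cocompact

/-- The convolution theorem for a square integrable and a Schwartz function. -/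
theorem SchwartzMap.exists_toLp_convolution (k : 𝓢(ℝ, ℂ)) (f : Lp ℂ 2 (volume : Measure ℝ)) :
    ∃ g : Lp ℂ 2 (volume : Measure ℝ),
      g =ᵐ[volume] MeasureTheory.convolution f k (ContinuousLinearMap.mul ℂ ℂ) volume ∧
      Lp.fourierTransformₗᵢ ℝ ℂ g =ᵐ[volume]
        fun ξ => 𝓕 k ξ * Lp.fourierTransformₗᵢ ℝ ℂ f ξ := by
  let H : Lp ℂ 2 (volume : Measure ℝ) →L[ℂ] Lp ℂ 2 (volume : Measure ℝ) :=
    (ContinuousLinearMap.mul ℂ ℂ).holderL volume ∞ 2 2 ((𝓕 k).toLp ∞ volume)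
  have hH : ∀ h, H h =ᵐ[volume] fun ξ => 𝓕 k ξ * h ξ := fun h => by
    filter_upwards [(ContinuousLinearMap.mul ℂ ℂ).coeFn_holder (r := 2)
      ((𝓕 k).toLp ∞ volume) h, (𝓕 k).coeFn_toLp ∞ volume] with ξ h1 h2
    refine h1.trans ?_
    rw [h2]
    rfl
  -- $S=\mathcal F^{-1}(\mathcal Fk)\mathcal F$ is continuous on $L^2$ and agrees with convolution
  -- by `k` on Schwartz functions.
  let S : Lp ℂ 2 (volume : Measure ℝ) → Lp ℂ 2 (volume : Measure ℝ) := fun h =>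
    (Lp.fourierTransformₗᵢ ℝ ℂ).symm (H (Lp.fourierTransformₗᵢ ℝ ℂ h))
  have hS : ∀ h, Lp.fourierTransformₗᵢ ℝ ℂ (S h) = H (Lp.fourierTransformₗᵢ ℝ ℂ h) := fun h =>
    (Lp.fourierTransformₗᵢ ℝ ℂ).apply_symm_apply _
  have hSc : Continuous S := (Lp.fourierTransformₗᵢ ℝ ℂ).symm.continuous.comp
    (H.continuous.comp (Lp.fourierTransformₗᵢ ℝ ℂ).continuous)
  have hSs : ∀ φ : 𝓢(ℝ, ℂ), S (φ.toLp 2 volume)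
      = (SchwartzMap.convolution (ContinuousLinearMap.mul ℂ ℂ) φ k).toLp 2 volume := fun φ => by
    apply (Lp.fourierTransformₗᵢ ℝ ℂ).injective
    rw [hS]
    change H (𝓕 (φ.toLp 2 volume))
      = 𝓕 ((SchwartzMap.convolution (ContinuousLinearMap.mul ℂ ℂ) φ k).toLp 2 volume)
    rw [SchwartzMap.toLp_fourier_eq, SchwartzMap.toLp_fourier_eq, SchwartzMap.fourier_convolution]
    refine Lp.ext ?_
    filter_upwards [hH ((𝓕 φ).toLp 2 volume), (𝓕 φ).coeFn_toLp 2 volume,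
      (SchwartzMap.pairing (ContinuousLinearMap.mul ℂ ℂ) (𝓕 φ) (𝓕 k)).coeFn_toLp 2 volume]
      with ξ h1 h2 h3
    rw [h1, h2, h3, mul_comm]
    rfl
  refine ⟨S f, ?_, by rw [hS]; exact hH _⟩
  obtain ⟨φ, hφ⟩ := mem_closure_iff_seq_limit.1
    ((SchwartzMap.denseRange_toLpCLM (F := ℂ) (μ := (volume : Measure ℝ))
      (ENNReal.ofNat_ne_top (n := 2))) f)
  choose ψ hψ using hφ.1
  have hlim : Tendsto (fun n => (ψ n).toLp 2 volume) atTop (𝓝 f) := by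
    refine hφ.2.congr fun n => ?_
    rw [← hψ n]
    rfl
  obtain ⟨ns, hns, hae⟩ := (tendstoInMeasure_of_tendsto_Lp
    ((hSc.tendsto f).comp hlim)).exists_seq_tendsto_ae
  have hpt : ∀ x, MemLp (fun t => k (x - t)) 2 volume := fun x =>
    (k.memLp 2 volume).comp_measurePreserving (Measure.measurePreserving_sub_left volume x)
  -- For fixed `x`, the value $(h*k)(x)$ is a pairing of `h` with the $L^2$ function $k(x-\cdot)$,
  -- hence continuous in `h`. It therefore has the same limit as the almost everywhere convergent
  -- subsequence of $S\psi_n$.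
  have hconv : ∀ (h : Lp ℂ 2 (volume : Measure ℝ)) x,
      (ContinuousLinearMap.mul ℂ ℂ).lpPairing volume 2 2 h ((hpt x).toLp _)
        = MeasureTheory.convolution h k (ContinuousLinearMap.mul ℂ ℂ) volume x := fun h x => by
    rw [ContinuousLinearMap.lpPairing_eq_integral, convolution_def]
    refine integral_congr_ae ?_
    filter_upwards [(hpt x).coeFn_toLp] with t ht
    rw [ht]
  have hall : ∀ᵐ x, ∀ n, S ((ψ n).toLp 2 volume) x
      = MeasureTheory.convolution ((ψ n).toLp 2 volume) k (ContinuousLinearMap.mul ℂ ℂ) volume x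
      := by
    refine ae_all_iff.2 fun n => ?_
    rw [hSs]
    filter_upwards [(SchwartzMap.convolution (ContinuousLinearMap.mul ℂ ℂ) (ψ n) k).coeFn_toLp 2
      volume] with x hx
    rw [hx, SchwartzMap.convolution_apply,
      convolution_congr _ ((ψ n).coeFn_toLp 2 volume) (ae_eq_refl _)]
  filter_upwards [hae, hall] with x h1 h2
  refine tendsto_nhds_unique h1 ?_
  simp only [Function.comp_apply, h2, ← hconv]
  have hc : Continuous fun h : Lp ℂ 2 (volume : Measure ℝ) =>
      (ContinuousLinearMap.mul ℂ ℂ).lpPairing volume 2 2 h ((hpt x).toLp _) :=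
    (((ContinuousLinearMap.mul ℂ ℂ).lpPairing volume 2 2).flip ((hpt x).toLp _)).continuous
  exact (hc.tendsto f).comp (hlim.comp hns.tendsto_atTop)

/-- The Fourier transform `x ↦ (𝓕 k)(-x / (2π))` of a Schwartz function. -/
def SchwartzMap.symbol (k : 𝓢(ℝ, ℂ)) : 𝓢(ℝ, ℂ) :=
  SchwartzMap.compCLMOfContinuousLinearEquiv ℂ
    (ContinuousLinearEquiv.unitsEquivAut ℝ
      (Units.mk0 (-(2 * Real.pi)⁻¹) (neg_ne_zero.2 (inv_ne_zero Real.two_pi_pos.ne')))) (𝓕 k)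

theorem SchwartzMap.symbol_apply (k : 𝓢(ℝ, ℂ)) (x : ℝ) :
    k.symbol x = 𝓕 k (-x / (2 * Real.pi)) := by
  rw [SchwartzMap.symbol, SchwartzMap.compCLMOfContinuousLinearEquiv_apply]
  simp only [Function.comp_apply, ContinuousLinearEquiv.unitsEquivAut_apply, Units.val_mk0]
  congr 1
  ring

namespace BanachFunctionNorm

variable {ρ : BanachFunctionNorm}

/-- The convolution theorem transported by the dilation $x\mapsto-x/(2\pi)$, which pulls null sets
back to null sets. -/
theorem isFourierConvolution_of_convolution (k : 𝓢(ℝ, ℂ)) (W : ρ.Space →L[ℂ] ρ.Space)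
    (hW : ∀ f : ρ.Space,
      (W f).val =ᵐ[volume] MeasureTheory.convolution f.val k (ContinuousLinearMap.mul ℂ ℂ) volume) :
    ρ.IsFourierConvolution k.symbol W := by
  intro f hf
  obtain ⟨g, hg, hgF⟩ := k.exists_toLp_convolution (hf.toLp _)
  have hWg : (W f).val =ᵐ[volume] g := by
    filter_upwards [hW f, hg] with x h1 h2
    rw [h1, h2, convolution_congr _ hf.coeFn_toLp (ae_eq_refl _)]
  have hmem : MemLp (W f).val 2 volume := (memLp_congr_ae hWg).2 (Lp.memLp g)
  have hto : hmem.toLp _ = g := Lp.ext (hmem.coeFn_toLp.trans hWg)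
  refine ⟨hmem, ?_⟩
  have hq := Measure.quasiMeasurePreserving_smul (volume : Measure ℝ)
    (neg_ne_zero.2 (inv_ne_zero Real.two_pi_pos.ne'))
  filter_upwards [hq.ae hgF] with x hx
  have hr : -(2 * Real.pi)⁻¹ • x = -x / (2 * Real.pi) := by
    rw [smul_eq_mul]
    ring
  rw [hr] at hx
  rw [fourierL2, hto, fourierL2, SchwartzMap.symbol_apply]
  exact hx

/-! ### Operators of rank one -/

theorem mulOp_mem_convolutionAlgebra (a : C(OnePoint ℝ, ℂ)) :
    ρ.mulOp a ∈ ρ.convolutionAlgebra :=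
  Subalgebra.le_topologicalClosure _ (Algebra.subset_adjoin (Or.inl ⟨a, rfl⟩))

theorem convolution_mem_convolutionAlgebra (b : 𝓢(ℝ, ℂ)) {W : ρ.Space →L[ℂ] ρ.Space}
    (hW : ρ.IsFourierConvolution b W) : W ∈ ρ.convolutionAlgebra := by
  refine Subalgebra.le_topologicalClosure _ (Algebra.subset_adjoin (Or.inr ⟨b, ?_, hW⟩))
  refine ⟨b.memLp ∞ volume, W, hW, fun ε hε => ⟨b, b.mem_continuousBV, W, hW, ?_⟩⟩
  rwa [sub_self, norm_zero]

/-- The extension by zero at infinity of a continuous function with compact support. -/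
def extendOnePoint (u : ℝ → ℂ) (hc : Continuous u) (hs : HasCompactSupport u) :
    C(OnePoint ℝ, ℂ) :=
  OnePoint.continuousMapMk ⟨u, hc⟩ 0 (by
    rw [coclosedCompact_eq_cocompact]
    exact hs.is_zero_at_infty)

/-- Compact support gives boundedness of the convolution through the maximal function; smoothness
gives a Schwartz symbol. -/
theorem exists_schwartz_eq_one (R : ℝ≥0) :
    ∃ k : 𝓢(ℝ, ℂ), HasCompactSupport k ∧ ∀ x : ℝ, |x| ≤ R → k x = 1 := by
  let φ : ContDiffBump (0 : ℝ) := ⟨R + 1, R + 2, by positivity, by linarith⟩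
  have hs : HasCompactSupport fun x => (φ x : ℂ) :=
    φ.hasCompactSupport.comp_left (g := fun r : ℝ => (r : ℂ)) rfl
  refine ⟨hs.toSchwartzMap (Complex.ofRealCLM.contDiff.comp φ.contDiff), hs, fun x hx => ?_⟩
  change ((φ x : ℝ) : ℂ) = 1
  rw [φ.one_of_mem_closedBall, Complex.ofReal_one]
  rw [Metric.mem_closedBall, dist_zero_right, Real.norm_eq_abs]
  change |x| ≤ R + 1
  linarith

theorem MaximalBounded.pairing_smulRight_mem (hM : ρ.MaximalBounded) {u v : ℝ → ℂ}
    (huc : Continuous u) (hus : HasCompactSupport u) (hvc : Continuous v)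
    (hvs : HasCompactSupport v) :
    ((IsBoundedSupported.of_continuous huc hus).pairing : ρ.Space →L[ℂ] ℂ).smulRight
      (IsBoundedSupported.of_continuous hvc hvs).toSpace ∈ ρ.convolutionAlgebra := by
  obtain ⟨R, hR⟩ := hus.exists_subset_Icc
  obtain ⟨R', hR'⟩ := hvs.exists_subset_Icc
  -- $|x-t|\le R+R'$ whenever $v(x)u(t)\ne0$, so $k(x-t)$ drops out of the kernel.
  obtain ⟨k, hks, hk⟩ := exists_schwartz_eq_one (R + R')
  obtain ⟨W, hW⟩ := hM.exists_convolution k.continuous hks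
  have hmem := mul_mem (mul_mem (mulOp_mem_convolutionAlgebra (ρ := ρ) (extendOnePoint v hvc hvs))
    (convolution_mem_convolutionAlgebra k.symbol (isFourierConvolution_of_convolution k W hW)))
    (mulOp_mem_convolutionAlgebra (extendOnePoint u huc hus))
  convert hmem using 1
  ext f
  refine Space.ext_ae ?_
  let c : ℂ := ∫ x, u x * f.val x
  filter_upwards [Space.coeFn_smul c (IsBoundedSupported.of_continuous hvc hvs).toSpace,
    (IsBoundedSupported.of_continuous hvc hvs).coeFn_toSpace (ρ := ρ),
    hW (ρ.mulOp (extendOnePoint u huc hus) f),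
    Space.coeFn_mulOp (extendOnePoint v hvc hvs) (W (ρ.mulOp (extendOnePoint u huc hus) f))]
    with x h1 h2 h3 h4
  refine (h1.trans ?_).trans h4.symm
  rw [h2, h3, convolution_congr _ (Space.coeFn_mulOp (extendOnePoint u huc hus) f) (ae_eq_refl _)]
  change c * v x = v x * ∫ t, u t * f.val t * k (x - t)
  by_cases hx : x ∈ Set.Icc (-R' : ℝ) R'
  · rw [mul_comm]
    congr 1
    refine integral_congr_ae (ae_of_all _ fun t => ?_)
    by_cases ht : t ∈ Set.Icc (-R : ℝ) R
    · have h5 : k (x - t) = 1 := hk _ (by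
        push_cast
        rw [abs_le]
        constructor <;> linarith [hx.1, hx.2, ht.1, ht.2])
      simp only [h5, mul_one]
    · simp [hR t ht]
  · simp [hR' x hx]

theorem _root_.ContinuousLinearMap.apply_mem_of_span_dense {E F : Type*} [NormedAddCommGroup E]
    [NormedSpace ℂ E] [NormedAddCommGroup F] [NormedSpace ℂ F] (T : E →L[ℂ] F) {s : Set E}
    (hs : (Submodule.span ℂ s).topologicalClosure = ⊤) (q : Submodule ℂ F)
    (hq : IsClosed (q : Set F)) (h : ∀ x ∈ s, T x ∈ q) (x : E) : T x ∈ q := by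
  have h1 : (Submodule.span ℂ s).topologicalClosure ≤ q.comap (T : E →ₗ[ℂ] F) :=
    Submodule.topologicalClosure_minimal _ (Submodule.span_le.2 h) (hq.preimage T.continuous)
  exact h1 (hs ▸ Submodule.mem_top)

theorem isClosed_convolutionAlgebra :
    IsClosed ((Subalgebra.toSubmodule ρ.convolutionAlgebra : Submodule ℂ
      (ρ.Space →L[ℂ] ρ.Space)) : Set (ρ.Space →L[ℂ] ρ.Space)) :=
  Subalgebra.isClosed_topologicalClosure _

/-- The rank-one operator depends continuously on `g` and on `ψ`, and the algebra is closed, so each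
may be taken from a set with dense span. -/
theorem smulRight_mem_convolutionAlgebra (hrefl : ρ.IsReflexive) (hM : ρ.MaximalBounded)
    (ψ : ρ.Space →L[ℂ] ℂ) (g : ρ.Space) : ψ.smulRight g ∈ ρ.convolutionAlgebra := by
  refine ContinuousLinearMap.apply_mem_of_span_dense
    (ContinuousLinearMap.smulRightL ℂ ρ.Space ρ.Space ψ) hrefl.span_toSpace_dense
    (Subalgebra.toSubmodule ρ.convolutionAlgebra) isClosed_convolutionAlgebra ?_ g
  rintro _ ⟨v, hvc, hvs, rfl⟩
  refine ContinuousLinearMap.apply_mem_of_span_dense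
    ((ContinuousLinearMap.smulRightL ℂ ρ.Space ρ.Space).flip _) hrefl.span_pairing_dense
    (Subalgebra.toSubmodule ρ.convolutionAlgebra) isClosed_convolutionAlgebra ?_ ψ
  rintro _ ⟨u, huc, hus, rfl⟩
  exact hM.pairing_smulRight_mem huc hus hvc hvs

/-! ### Averaging operators -/

/-- The operator `f ↦ c (∫_[a,b) f) χ_[a,b)`. -/
def cellOp (ρ : BanachFunctionNorm) (a b : ℝ) (c : ℂ) : ρ.Space →L[ℂ] ρ.Space :=
  (IsBoundedSupported.indicator_Ico a b).pairing.smulRight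
    (c • (IsBoundedSupported.indicator_Ico a b).toSpace)

theorem coeFn_cellOp (a b : ℝ) (c : ℂ) (f : ρ.Space) :
    (ρ.cellOp a b c f).val =ᵐ[volume] fun x =>
      if x ∈ Set.Ico a b then (∫ t in Set.Ico a b, f.val t) * c else 0 := by
  rw [cellOp, ContinuousLinearMap.smulRight_apply, smul_smul, IsBoundedSupported.pairing_apply]
  filter_upwards [Space.coeFn_smul ((∫ x, (Set.Ico a b).indicator (fun _ => 1) x * f.val x) * c)
    (IsBoundedSupported.indicator_Ico a b).toSpace,
    (IsBoundedSupported.indicator_Ico a b).coeFn_toSpace (ρ := ρ)] with x h2 h3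
  rw [h2, h3, ← integral_indicator measurableSet_Ico]
  simp only [Set.indicator_apply, ite_mul, mul_ite, one_mul, zero_mul, mul_one, mul_zero]

/-- The averaging operator over the intervals of length `(n + 1)⁻¹` between `-(n + 1)` and
`n + 1`. -/
def averageOp (ρ : BanachFunctionNorm) (n : ℕ) : ρ.Space →L[ℂ] ρ.Space :=
  ∑ j ∈ Finset.Ico (-((n + 1 : ℤ) ^ 2)) ((n + 1 : ℤ) ^ 2),
    ρ.cellOp ((j : ℝ) / (n + 1)) ((j + 1 : ℝ) / (n + 1)) (n + 1)

/-- Each point lies in exactly one cell, so the sum defining `averageOp` has at most one nonzero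
term there. -/
theorem mem_grid_iff (n : ℕ) (j : ℤ) (x : ℝ) :
    x ∈ Set.Ico ((j : ℝ) / (n + 1)) ((j + 1 : ℝ) / (n + 1)) ↔ ⌊x * (n + 1)⌋ = j := by
  have hn : (0 : ℝ) < n + 1 := by positivity
  rw [Int.floor_eq_iff, Set.mem_Ico, div_le_iff₀ hn, lt_div_iff₀ hn]

theorem coeFn_averageOp (n : ℕ) (f : ρ.Space) :
    (ρ.averageOp n f).val =ᵐ[volume] fun x =>
      if ⌊x * (n + 1)⌋ ∈ Finset.Ico (-((n + 1 : ℤ) ^ 2)) ((n + 1 : ℤ) ^ 2) then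
        (∫ t in Set.Ico ((⌊x * (n + 1)⌋ : ℝ) / (n + 1)) ((⌊x * (n + 1)⌋ + 1 : ℝ) / (n + 1)),
          f.val t) * (n + 1)
      else 0 := by
  rw [averageOp, sum_apply]
  filter_upwards [ae_all_iff.2 fun j : ℤ => coeFn_cellOp (ρ := ρ) ((j : ℝ) / (n + 1))
      ((j + 1 : ℝ) / (n + 1)) (n + 1) f,
    Space.coeFn_sum (Finset.Ico (-((n + 1 : ℤ) ^ 2)) ((n + 1 : ℤ) ^ 2)) fun j : ℤ =>
      ρ.cellOp ((j : ℝ) / (n + 1)) ((j + 1 : ℝ) / (n + 1)) (n + 1) f] with x h1 h2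
  rw [h2, Finset.sum_congr rfl fun j _ => h1 j]
  simp only [mem_grid_iff]
  rw [Finset.sum_ite_eq]

/-- At `x` the value is zero or the mean of `f` over a cell containing `x`, hence at most $Mf(x)$ in
modulus, whatever `n` is. -/
theorem MaximalBounded.exists_norm_averageOp_le (hM : ρ.MaximalBounded) :
    ∃ D : ℝ≥0, ∀ n, ‖ρ.averageOp n‖ ≤ D := by
  obtain ⟨D, hD⟩ := hM.exists_bound
  refine ⟨D, fun n => ContinuousLinearMap.opNorm_le_bound _ D.2 fun f => ?_⟩
  refine norm_le_mul_norm_of_enorm_le ?_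
  rw [Space.enorm_def]
  refine (hD f _ 1 (aemeasurable_enorm _) ?_).trans_eq (by rw [one_mul])
  filter_upwards [coeFn_averageOp n f] with x hx
  rw [hx]
  split_ifs
  · have hn : (0 : ℝ) < n + 1 := by positivity
    have hmem := (mem_grid_iff n ⌊x * (n + 1)⌋ x).2 rfl
    have hlen : ((⌊x * (n + 1)⌋ + 1 : ℝ) / (n + 1)) - ((⌊x * (n + 1)⌋ : ℝ) / (n + 1))
        = (n + 1 : ℝ)⁻¹ := by
      field_simp
      ring
    have hcast : ‖(n + 1 : ℂ)‖ₑ = (ENNReal.ofReal (n + 1 : ℝ)⁻¹)⁻¹ := by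
      rw [ENNReal.ofReal_inv_of_pos hn, inv_inv, ← ofReal_norm]
      congr 1
      have : (n + 1 : ℂ) = ((n + 1 : ℕ) : ℂ) := by push_cast; rfl
      rw [this, Complex.norm_natCast]
      push_cast
      rfl
    rw [enorm_mul, ENNReal.coe_one, one_mul, hcast, ← hlen, ← div_eq_mul_inv]
    refine le_trans ?_ (le_maximalFunction (hmem.1.trans_lt hmem.2) (Set.Ico_subset_Icc_self hmem))
    gcongr
    exact (enorm_integral_le_lintegral_enorm _).trans
      (lintegral_mono_set Set.Ico_subset_Icc_self)
  · simp

theorem norm_average_sub_le {v : ℝ → ℂ} (hv : Continuous v) (n : ℕ) {a b : ℝ}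
    (hab : b - a = (n + 1 : ℝ)⁻¹) (x : ℝ) {η : ℝ} (h : ∀ t ∈ Set.Ico a b, ‖v t - v x‖ ≤ η) :
    ‖(∫ t in Set.Ico a b, v t) * (n + 1) - v x‖ ≤ η := by
  have hn : (0 : ℝ) < n + 1 := by positivity
  have hn' : (n + 1 : ℂ) ≠ 0 := by exact_mod_cast hn.ne'
  have hvol : volume.real (Set.Ico a b) = (n + 1 : ℝ)⁻¹ := by
    rw [Real.volume_real_Ico, hab]
    exact max_eq_left (by positivity)
  have hint : IntegrableOn v (Set.Ico a b) volume :=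
    (hv.integrableOn_Icc).mono_set Set.Ico_subset_Icc_self
  have h1 : ∫ t in Set.Ico a b, (v t - v x) = (∫ t in Set.Ico a b, v t) - (n + 1 : ℂ)⁻¹ * v x := by
    rw [integral_sub hint (integrableOn_const (by simp)), setIntegral_const, hvol,
      Complex.real_smul]
    push_cast
    rfl
  have h2 : (∫ t in Set.Ico a b, v t) * (n + 1) - v x
      = (∫ t in Set.Ico a b, (v t - v x)) * (n + 1) := by
    rw [h1]
    field_simp
  have h3 := norm_setIntegral_le_of_norm_le_const (μ := volume) (s := Set.Ico a b) (by simp) h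
  rw [hvol] at h3
  have hcast : ‖(n + 1 : ℂ)‖ = n + 1 := by
    have : (n + 1 : ℂ) = ((n + 1 : ℕ) : ℂ) := by push_cast; rfl
    rw [this, Complex.norm_natCast]
    push_cast
    rfl
  rw [h2, norm_mul, hcast]
  calc _ ≤ η * (n + 1 : ℝ)⁻¹ * (n + 1) := by gcongr
    _ = η := by field_simp

/-- By uniform continuity the averages converge uniformly, and all differences eventually vanish off
$[-R-1,R+1]$, whose indicator has finite norm. -/
theorem tendsto_averageOp_toSpace {v : ℝ → ℂ} (hc : Continuous v) (hs : HasCompactSupport v) :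
    Tendsto (fun n => ρ.averageOp n (IsBoundedSupported.of_continuous hc hs).toSpace) atTop
      (𝓝 (IsBoundedSupported.of_continuous hc hs).toSpace) := by
  set f : ρ.Space := (IsBoundedSupported.of_continuous hc hs).toSpace with hf
  obtain ⟨R, hR⟩ := hs.exists_subset_Icc
  have huc : UniformContinuous v := hs.uniformContinuous_of_continuous hc
  set B := (ρ.toFun ((Set.Icc (-(R + 1 : ℝ≥0) : ℝ) (R + 1 : ℝ≥0)).indicator fun _ => 1)).toReal
  have hB : 0 ≤ B := ENNReal.toReal_nonneg
  have key : ∀ η : ℝ≥0, 0 < η → ∀ᶠ n in atTop, ‖ρ.averageOp n f - f‖ ≤ η * B := by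
    intro η hη
    obtain ⟨δ, hδ, hδv⟩ := Metric.uniformContinuous_iff.1 huc η hη
    obtain ⟨N, hN⟩ := exists_nat_ge (max (R : ℝ) δ⁻¹)
    filter_upwards [eventually_ge_atTop N] with n hnN
    have hn : (0 : ℝ) < n + 1 := by positivity
    have hn1 : (N : ℝ) ≤ n := by exact_mod_cast hnN
    have hnR : (R : ℝ) < n + 1 := by linarith [(le_max_left _ _).trans hN]
    have hnδ : (n + 1 : ℝ)⁻¹ < δ := by
      rw [inv_lt_comm₀ hn hδ]
      linarith [(le_max_right _ _).trans hN]
    have hn1' : (n + 1 : ℝ)⁻¹ ≤ 1 := inv_le_one_of_one_le₀ (by linarith [n.cast_nonneg (α := ℝ)])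
    refine Space.norm_le_of_bound ?_
    filter_upwards [Space.coeFn_sub (ρ.averageOp n f) f, coeFn_averageOp n f,
      (IsBoundedSupported.of_continuous hc hs).coeFn_toSpace (ρ := ρ)] with x h1 h2 h3
    have hint : ∀ s : Set ℝ, ∫ t in s, f.val t = ∫ t in s, v t := fun s =>
      integral_congr_ae (ae_restrict_of_ae (IsBoundedSupported.of_continuous hc hs).coeFn_toSpace)
    rw [h1, h2, hf, h3, ← hf, hint]
    have hmem := (mem_grid_iff n ⌊x * (n + 1)⌋ x).2 rfl
    have hlen : ((⌊x * (n + 1)⌋ + 1 : ℝ) / (n + 1)) - ((⌊x * (n + 1)⌋ : ℝ) / (n + 1))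
        = (n + 1 : ℝ)⁻¹ := by
      field_simp
      ring
    have hclose : ∀ t ∈ Set.Ico ((⌊x * (n + 1)⌋ : ℝ) / (n + 1))
        ((⌊x * (n + 1)⌋ + 1 : ℝ) / (n + 1)), |t - x| < (n + 1 : ℝ)⁻¹ := fun t ht => by
      rw [abs_lt]
      constructor <;> linarith [ht.1, ht.2, hmem.1, hmem.2]
    -- Inside the grid, uniform continuity applies near the support, and farther out the whole cell
    -- misses the support. Outside the grid `v x = 0`, since `R < n + 1`.
    split_ifs with hj
    · by_cases hx : x ∈ Set.Icc (-((R + 1 : ℝ≥0) : ℝ)) ((R + 1 : ℝ≥0) : ℝ)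
      · rw [Set.indicator_of_mem hx, enorm_eq_nnnorm]
        have h4 := norm_average_sub_le hc n hlen x (η := η) fun t ht => by
          rw [← dist_eq_norm]
          refine (hδv ?_).le
          rw [Real.dist_eq]
          exact (hclose t ht).trans hnδ
        exact_mod_cast h4
      · have hv0 : ∀ t, |t - x| < (n + 1 : ℝ)⁻¹ → v t = 0 := fun t ht => hR t fun hmem => hx (by
          rw [abs_lt] at ht
          push_cast
          constructor <;> linarith [hmem.1, hmem.2, ht.1, ht.2])
        have h4 := norm_average_sub_le hc n hlen x (η := 0) fun t ht => by
          rw [hv0 t (hclose t ht), hv0 x (by rw [sub_self, abs_zero]; positivity), sub_self,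
            norm_zero]
        rw [norm_le_zero_iff.1 h4]
        simp
    · have hx0 : v x = 0 := hR x fun hx => hj (by
        rw [Finset.mem_Ico, Int.le_floor, Int.floor_lt]
        push_cast
        constructor <;> nlinarith [hx.1, hx.2])
      simp [hx0]
  rw [tendsto_iff_norm_sub_tendsto_zero, Metric.tendsto_atTop]
  intro ε hε
  have hη : 0 < ε / (B + 1) := by positivity
  obtain ⟨N, hN⟩ := eventually_atTop.1 (key ⟨ε / (B + 1), hη.le⟩ hη)
  refine ⟨N, fun n hn => ?_⟩
  rw [dist_zero_right, norm_norm]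
  refine (hN n hn).trans_lt ?_
  change ε / (B + 1) * B < ε
  rw [div_mul_eq_mul_div, div_lt_iff₀ (by positivity)]
  nlinarith

/-! ### From strong convergence to norm convergence along a compact operator. -/

/-- Pointwise convergence of a bounded sequence of operators extends from a set with dense span
to the whole space. -/
theorem _root_.ContinuousLinearMap.tendsto_of_span_dense {E : Type*} [NormedAddCommGroup E]
    [NormedSpace ℂ E] (T : ℕ → E →L[ℂ] E) (D : ℝ) (hD : ∀ n, ‖T n‖ ≤ D) {s : Set E}
    (hs : (Submodule.span ℂ s).topologicalClosure = ⊤)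
    (h : ∀ x ∈ s, Tendsto (fun n => T n x) atTop (𝓝 0)) (x : E) :
    Tendsto (fun n => T n x) atTop (𝓝 0) := by
  let p : Submodule ℂ E :=
    { carrier := {x | Tendsto (fun n => T n x) atTop (𝓝 0)}
      zero_mem' := by simp
      add_mem' := fun {a b} ha hb => by
        have h1 := Tendsto.add ha hb
        rw [add_zero] at h1
        exact h1.congr fun n => ((T n).map_add a b).symm
      smul_mem' := fun c a ha => by
        have h1 := Tendsto.const_smul ha c
        rw [smul_zero] at h1
        exact h1.congr fun n => ((T n).map_smul c a).symm }
  have hD0 : 0 ≤ D := (norm_nonneg _).trans (hD 0)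
  have hx : x ∈ (Submodule.span ℂ s).topologicalClosure := hs ▸ Submodule.mem_top
  have hsp : Submodule.span ℂ s ≤ p := Submodule.span_le.2 h
  rw [Metric.tendsto_atTop]
  intro ε hε
  obtain ⟨y, hy, hxy⟩ := Metric.mem_closure_iff.1 hx (ε / (2 * (D + 1))) (by positivity)
  obtain ⟨N, hN⟩ := Metric.tendsto_atTop.1 (hsp hy : Tendsto (fun n => T n y) atTop (𝓝 0)) (ε / 2)
    (by positivity)
  refine ⟨N, fun n hn => ?_⟩
  have h1 := hN n hn
  rw [dist_zero_right] at h1 ⊢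
  rw [dist_eq_norm, lt_div_iff₀ (by positivity)] at hxy
  have h2 : ‖T n (x - y)‖ ≤ D * ‖x - y‖ := (T n).le_of_opNorm_le (hD n) _
  calc ‖T n x‖ = ‖T n (x - y) + T n y‖ := by rw [← map_add, sub_add_cancel]
    _ ≤ ‖T n (x - y)‖ + ‖T n y‖ := norm_add_le _ _
    _ < ε := by nlinarith [norm_nonneg (x - y)]

/-- A bounded sequence of operators that tends to zero pointwise tends to zero in norm after
composition with a compact operator. -/
theorem _root_.IsCompactOperator.tendsto_comp {E : Type*} [NormedAddCommGroup E]
    [NormedSpace ℂ E] {K : E →L[ℂ] E} (hK : IsCompactOperator K) (T : ℕ → E →L[ℂ] E) (D : ℝ)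
    (hD : ∀ n, ‖T n‖ ≤ D) (h : ∀ x, Tendsto (fun n => T n x) atTop (𝓝 0)) :
    Tendsto (fun n => T n ∘L K) atTop (𝓝 0) := by
  have hD0 : 0 ≤ D := (norm_nonneg _).trans (hD 0)
  obtain ⟨C, hC, hKC⟩ := IsCompactOperator.image_closedBall_subset_compact
    (f := (K : E →ₗ[ℂ] E)) hK 1
  rw [Metric.tendsto_atTop]
  intro ε hε
  -- A finite net for a compact set containing the image of the unit ball. Convergence is uniform on
  -- the net, and the bound `D` controls the distance to it.
  obtain ⟨t, ht, hcov⟩ := Metric.totallyBounded_iff.1 hC.totallyBounded (ε / (4 * (D + 1)))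
    (by positivity)
  have hev : ∀ᶠ n in atTop, ∀ y ∈ t, ‖T n y‖ < ε / 4 := (Set.Finite.eventually_all ht).2
    fun y _ => by
      have h1 := (h y).norm
      rw [norm_zero] at h1
      exact h1.eventually (gt_mem_nhds (by positivity))
  obtain ⟨N, hN⟩ := eventually_atTop.1 hev
  refine ⟨N, fun n hn => ?_⟩
  rw [dist_zero_right]
  refine (ContinuousLinearMap.opNorm_le_of_unit_norm (C := ε / 2) (by positivity)
    fun x hx => ?_).trans_lt (half_lt_self hε)
  have hKx : K x ∈ C := hKC ⟨x, by simp [hx], rfl⟩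
  obtain ⟨y, hy, hxy⟩ := Set.mem_iUnion₂.1 (hcov hKx)
  rw [Metric.mem_ball, dist_eq_norm, lt_div_iff₀ (by positivity)] at hxy
  have h2 : ‖T n (K x - y)‖ ≤ D * ‖K x - y‖ := (T n).le_of_opNorm_le (hD n) _
  have h1 := hN n hn y hy
  calc ‖T n (K x)‖ = ‖T n (K x - y) + T n y‖ := by rw [← map_add, sub_add_cancel]
    _ ≤ ‖T n (K x - y)‖ + ‖T n y‖ := norm_add_le _ _
    _ ≤ ε / 2 := by nlinarith [norm_nonneg (K x - y)]

end BanachFunctionNorm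
end

theorem theorem1p1 (ρ : BanachFunctionNorm) (hrefl : ρ.IsReflexive)
    (hM : ρ.MaximalBounded) (hM' : ρ.associate.MaximalBounded)
    (K : ρ.Space →L[ℂ] ρ.Space) (hK : IsCompactOperator K) :
    K ∈ ρ.convolutionAlgebra := by
  obtain ⟨D, hD⟩ := hM.exists_norm_averageOp_le
  have hD1 : ∀ n, ‖ρ.averageOp n - 1‖ ≤ D + 1 := fun n =>
    (norm_sub_le _ _).trans (add_le_add (hD n) ContinuousLinearMap.norm_id_le)
  have hlim : Tendsto (fun n => (ρ.averageOp n - 1) ∘L K) atTop (𝓝 0) := by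
    refine hK.tendsto_comp _ _ hD1 (ContinuousLinearMap.tendsto_of_span_dense _ _ hD1
      hrefl.span_toSpace_dense ?_)
    rintro _ ⟨v, hvc, hvs, rfl⟩
    exact tendsto_sub_nhds_zero_iff.2 (BanachFunctionNorm.tendsto_averageOp_toSpace hvc hvs)
  have hlim' : Tendsto (fun n => ρ.averageOp n ∘L K) atTop (𝓝 K) := by
    refine tendsto_sub_nhds_zero_iff.1 (hlim.congr fun n => ?_)
    ext1 f
    rfl
  refine BanachFunctionNorm.isClosed_convolutionAlgebra.mem_of_tendsto hlim'
    (Eventually.of_forall fun n => ?_)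
  -- Each summand composed with `K` is again of rank one, with functional $f\mapsto\int_{[a,b)}Kf$.
  rw [BanachFunctionNorm.averageOp, ContinuousLinearMap.finsetSum_comp]
  exact sum_mem fun j _ => BanachFunctionNorm.smulRight_mem_convolutionAlgebra hrefl hM
    ((BanachFunctionNorm.IsBoundedSupported.indicator_Ico _ _).pairing ∘L K) _
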